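/- Let $T=(V,E)$ be a free tree on $n\ge 1$ vertices, $V=\{0,\dots,n-1\}$. A linear arrangement of $T$ is a bijection $\pi:V\to\{1,\dots,n\}$; it is planar if there are no edges $st,uv\in E$ with $\pi(s)<\pi(u)<\pi(t)<\pi(v)$. Let $D_\pi(T)=\sum_{uv\in E}|\pi(u)-\pi(v)|$, and let $\mathbb{E}_{\mathrm{pl}}[D]$ be the expected value of $D_\pi(T)$ when $\pi$ is drawn uniformly at random among the planar arrangements of $T$. For an edge $uv$, let the directional subtree size $s_u(v)$ be the number of vertices of the subtree of $v$ when $T$ is rooted at $u$. Consider the following algorithm, whose input is $T$, given by arrays that list the neighbours of each vertex in any order. (1) Compute the set $S=\{(u,v,s_u(v)),(v,u,s_v(u)) : uv\in E\}$ recursively: for every neighbour $w$ of the vertex $0$ call $\mathrm{sizes}(0,w)$, where $\mathrm{sizes}(u,v)$ starts with $s:=1$, adds $\mathrm{sizes}(v,w)$ to $s$ for every neighbour $w\ne u$ of $v$, adds the triples $(u,v,s)$ and $(v,u,n-s)$ to $S$, and returns $s$. (2) Set $L[v]:=0$ for all $v\in V$ and, for each $(u,v,s)\in S$, add $s^2$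 to $L[u]$. (3) Return, as a fraction, $$\frac{(n-1)(3n^2+2n-2)-\sum_{v\in V}(2\deg(v)-1)\,L[v]}{6n}.$$ For every free tree $T$ the algorithm terminates and returns $\mathbb{E}_{\mathrm{pl}}[D]$, and it runs in $O(n)$ time and $O(n)$ space: there is a constant $C$, independent of $n$, of $T$ and of the order of the neighbours, such that on a random access machine with unit-cost operations on integers the computation takes at most $Cn$ units of time, uses at all times at most $Cn$ words of space (input, working arrays, local variables and recursion stack included), and keeps in memory only integers of absolute value at most $Cn^3$, that is, of $O(\log n)$ bits. -/

import Mathlib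

namespace PlanarSum

/-! ## Linear arrangements of a tree and the expected sum of edge lengths -/

/-- A linear arrangement of the vertices `0, …, n - 1`: a bijection from the vertices onto the `n`
positions.  Positions are numbered from `0`; only their order and their differences matter. -/
abbrev Arrangement (n : ℕ) : Type := Equiv.Perm (Fin n)

/-- An arrangement is planar if no two edges `st`, `uv` cross, that is, never
`π s < π u < π t < π v`. -/
def IsPlanar {n : ℕ} (G : SimpleGraph (Fin n)) (π : Arrangement n) : Prop :=
  ∀ s t u v : Fin n, G.Adj s t → G.Adj u v → ¬ (π s < π u ∧ π u < π t ∧ π t < π v)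

/-- The length `|π u - π v|` of the pair `uv` in the arrangement `π`. -/
def edgeLength {n : ℕ} (π : Arrangement n) : Sym2 (Fin n) → ℤ :=
  Sym2.lift ⟨fun u v => |((π u : ℕ) : ℤ) - ((π v : ℕ) : ℤ)|, fun _ _ => abs_sub_comm _ _⟩

open Classical in
/-- The sum `D` of the lengths of all (undirected) edges in the arrangement `π`. -/
noncomputable def sumEdgeLengths {n : ℕ} (G : SimpleGraph (Fin n)) (π : Arrangement n) : ℤ :=
  ∑ e ∈ G.edgeFinset, edgeLength π e

open Classical in
/-- The set of the planar arrangements of `G`. -/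
noncomputable def planarArrangements {n : ℕ} (G : SimpleGraph (Fin n)) :
    Finset (Arrangement n) :=
  Finset.univ.filter (fun π => IsPlanar G π)

/-- The expected value of `D` in a uniformly random planar arrangement of `G`. -/
noncomputable def expectedPlanar {n : ℕ} (G : SimpleGraph (Fin n)) : ℚ :=
  (∑ π ∈ planarArrangements G, (sumEdgeLengths G π : ℚ)) / ((planarArrangements G).card : ℚ)

/-! ## A random access machine with integer words, arrays and recursive procedures -/

/-- The read-only input: for every vertex an array that lists vertices. -/
abbrev AdjLists (n : ℕ) : Type := Fin n → List (Fin n)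

/-- `A` is an adjacency list representation of `G`: the array of `v` lists the neighbours of `v`,
each once, in any order. -/
def AdjLists.Represents {n : ℕ} (A : AdjLists n) (G : SimpleGraph (Fin n)) : Prop :=
  ∀ v : Fin n, (A v).Nodup ∧ ∀ w : Fin n, w ∈ A v ↔ G.Adj v w

/-- The number of words that the input takes. -/
def AdjLists.size {n : ℕ} (A : AdjLists n) : ℕ := n + ∑ v, (A v).length

/-- Reading `l[z]`; it fails if `z` is out of bounds. -/
def readAt (l : List ℤ) (z : ℤ) : Option ℤ := if 0 ≤ z then l[z.toNat]? else none

/-- The effect of `l[z] := w`; it fails if `z` is out of bounds. -/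
def writeAt (l : List ℤ) (z w : ℤ) : Option (List ℤ) :=
  if 0 ≤ z ∧ z.toNat < l.length then some (l.set z.toNat w) else none

/-- The length of the input array of the vertex `z`. -/
def degAt {n : ℕ} (A : AdjLists n) (z : ℤ) : Option ℤ :=
  if h : 0 ≤ z ∧ z.toNat < n then some ((A ⟨z.toNat, h.2⟩).length : ℤ) else none

/-- The entry number `i` (from `0`) of the input array of the vertex `z`. -/
def nbrAt {n : ℕ} (A : AdjLists n) (z i : ℤ) : Option ℤ :=
  if h : 0 ≤ z ∧ z.toNat < n then
    readAt ((A ⟨z.toNat, h.2⟩).map (fun w => ((w : ℕ) : ℤ))) i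
  else none

/-- Expressions. -/
inductive Exp : Type
  /-- an integer constant -/
  | lit (z : ℤ)
  /-- a local variable -/
  | var (x : ℕ)
  /-- the number of vertices of the input -/
  | size
  /-- the degree of a vertex -/
  | deg (v : Exp)
  /-- an entry of the adjacency array of a vertex -/
  | nbr (v i : Exp)
  /-- an entry of the working array `a` -/
  | get (a : ℕ) (i : Exp)
  | add (e f : Exp)
  | sub (e f : Exp)
  | mul (e f : Exp)

/-- The value of an expression, for the input `A`, the local variables `loc` and the working
arrays `heap`. -/
def Exp.eval {n : ℕ} (A : AdjLists n) (loc : List ℤ) (heap : List (List ℤ)) : Exp → Option ℤ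
  | .lit z => some z
  | .var x => loc[x]?
  | .size => some (n : ℤ)
  | .deg v => (v.eval A loc heap).bind fun z => degAt A z
  | .nbr v i => (v.eval A loc heap).bind fun z => (i.eval A loc heap).bind fun j => nbrAt A z j
  | .get a i => heap[a]?.bind fun l => (i.eval A loc heap).bind fun j => readAt l j
  | .add e f => (e.eval A loc heap).bind fun x => (f.eval A loc heap).bind fun y => some (x + y)
  | .sub e f => (e.eval A loc heap).bind fun x => (f.eval A loc heap).bind fun y => some (x - y)
  | .mul e f => (e.eval A loc heap).bind fun x => (f.eval A loc heap).bind fun y => some (x * y)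

/-- The number of elementary operations of an evaluation: one per node of the expression. -/
def Exp.cost : Exp → ℕ
  | .lit _ => 1
  | .var _ => 1
  | .size => 1
  | .deg v => v.cost + 1
  | .nbr v i => v.cost + i.cost + 1
  | .get _ i => i.cost + 1
  | .add e f => e.cost + f.cost + 1
  | .sub e f => e.cost + f.cost + 1
  | .mul e f => e.cost + f.cost + 1

/-- Tests. -/
inductive Test : Type
  | lt (e f : Exp)
  | ne (e f : Exp)

/-- The outcome of a test. -/
def Test.eval {n : ℕ} (A : AdjLists n) (loc : List ℤ) (heap : List (List ℤ)) : Test → Option Bool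
  | .lt e f => (e.eval A loc heap).bind fun x => (f.eval A loc heap).bind fun y =>
      some (decide (x < y))
  | .ne e f => (e.eval A loc heap).bind fun x => (f.eval A loc heap).bind fun y =>
      some (decide (x ≠ y))

/-- The number of elementary operations of a test. -/
def Test.cost : Test → ℕ
  | .lt e f => e.cost + f.cost + 1
  | .ne e f => e.cost + f.cost + 1

/-- Statements. -/
inductive Stmt : Type
  /-- `x := e` for a local variable `x` -/
  | assign (x : ℕ) (e : Exp)
  /-- `a[i] := e` for a working array `a` -/
  | store (a : ℕ) (i e : Exp)
  /-- make `a` an array of length `e` filled with zeros -/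
  | alloc (a : ℕ) (e : Exp)
  /-- run `body` if the test `c` succeeds, and do nothing otherwise -/
  | cond (c : Test) (body : List Stmt)
  /-- run `body` as long as the test `c` succeeds -/
  | loop (c : Test) (body : List Stmt)
  /-- `x := p(args)` for the procedure number `p`, by value -/
  | call (x p : ℕ) (args : List Exp)
  /-- return the value of `e` to the caller -/
  | ret (e : Exp)

/-- A procedure: the number of its local variables, the first of which hold the arguments, and
its body. -/
structure Proc : Type where
  locals : ℕ
  body : List Stmt

/-- A program: its procedures, the number of its working arrays, its main procedure, and the two
local variables of the main procedure that hold the numerator and the denominator of the result at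
the end of a computation. -/
structure Program : Type where
  procs : List Proc
  arrays : ℕ
  main : Proc
  num : ℕ
  den : ℕ

/-- The record of a suspended call: what its caller has still to do, the local variables of the
caller, and the variable that receives the returned value. -/
structure Act : Type where
  code : List Stmt
  loc : List ℤ
  dest : ℕ

/-- A configuration: the statements that the current procedure has still to run, its local
variables, the suspended callers, the working arrays, and the time that has passed. -/
structure Config : Type where
  code : List Stmt
  loc : List ℤ
  stack : List Act
  heap : List (List ℤ)
  clock : ℕ

/-- The values of the arguments of a call. -/
def evalArgs {n : ℕ} (A : AdjLists n) (loc : List ℤ) (heap : List (List ℤ)) :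
    List Exp → Option (List ℤ)
  | [] => some []
  | e :: es => (e.eval A loc heap).bind fun z => (evalArgs A loc heap es).bind fun zs =>
      some (z :: zs)

/-- One step of a computation.  It fails if nothing is left to do, or if the next statement reads
or writes a variable, an array entry or a procedure that does not exist.  A step takes one unit of
time, one more for each elementary operation in its expressions, and one more for each word that
it sets aside for an array or for the local variables of a procedure. -/
def step (P : Program) {n : ℕ} (A : AdjLists n) (c : Config) : Option Config :=
  match c.code with
  | [] => none
  | .assign x e :: rest =>
      (e.eval A c.loc c.heap).bind fun z =>
      if x < c.loc.length then
        some { c with code := rest, loc := c.loc.set x z, clock := c.clock + 1 + e.cost }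
      else none
  | .store a i e :: rest =>
      (i.eval A c.loc c.heap).bind fun j =>
      (e.eval A c.loc c.heap).bind fun z =>
      c.heap[a]?.bind fun l =>
      (writeAt l j z).bind fun l' =>
      some { c with
        code := rest, heap := c.heap.set a l', clock := c.clock + 1 + i.cost + e.cost }
  | .alloc a e :: rest =>
      (e.eval A c.loc c.heap).bind fun z =>
      if a < c.heap.length ∧ 0 ≤ z then
        some { c with
          code := rest, heap := c.heap.set a (List.replicate z.toNat 0),
          clock := c.clock + 1 + e.cost + z.toNat }
      else none
  | .cond t body :: rest =>
      (t.eval A c.loc c.heap).bind fun b =>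
      some { c with
        code := if b then body ++ rest else rest, clock := c.clock + 1 + t.cost }
  | .loop t body :: rest =>
      (t.eval A c.loc c.heap).bind fun b =>
      some { c with
        code := if b then body ++ .loop t body :: rest else rest,
        clock := c.clock + 1 + t.cost }
  | .call x p args :: rest =>
      P.procs[p]?.bind fun q =>
      (evalArgs A c.loc c.heap args).bind fun zs =>
      if zs.length ≤ q.locals then
        some
          { code := q.body
            loc := zs ++ List.replicate (q.locals - zs.length) 0
            stack := { code := rest, loc := c.loc, dest := x } :: c.stack
            heap := c.heap
            clock := c.clock + 1 + (args.map Exp.cost).sum + q.locals }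
      else none
  | .ret e :: _ =>
      (e.eval A c.loc c.heap).bind fun z =>
      match c.stack with
      | [] => none
      | act :: stack =>
          if act.dest < act.loc.length then
            some
              { code := act.code
                loc := act.loc.set act.dest z
                stack := stack
                heap := c.heap
                clock := c.clock + 1 + e.cost }
          else none

/-- The initial configuration. -/
def Program.init (P : Program) : Config where
  code := P.main.body
  loc := List.replicate P.main.locals 0
  stack := []
  heap := List.replicate P.arrays []
  clock := 0

/-- The configuration after `k` steps on the input `A`, if there are so many. -/
def Program.run (P : Program) {n : ℕ} (A : AdjLists n) : ℕ → Option Config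
  | 0 => some P.init
  | k + 1 => (P.run A k).bind (step P A)

/-- The computation has come to its end in the configuration `c`, with the result `p / q`. -/
def Program.Returns (P : Program) (c : Config) (p q : ℤ) : Prop :=
  c.code = [] ∧ c.stack = [] ∧ c.loc[P.num]? = some p ∧ c.loc[P.den]? = some q

/-- All words that the working memory holds: the local variables of the current procedure and of
its suspended callers, and the entries of the arrays. -/
def Config.words (c : Config) : List ℤ :=
  c.loc ++ c.stack.flatMap Act.loc ++ c.heap.flatten

/-- The space in use: the input, the words of the working memory, and the control information, one
unit for each pending statement and for each suspended call. -/
def Config.space {n : ℕ} (A : AdjLists n) (c : Config) : ℕ :=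
  A.size + c.words.length + c.code.length + (c.stack.map fun act => act.code.length + 1).sum

/-! ## The algorithm

The set `S` of the directional subtree sizes is kept in three arrays `src`, `dst`, `siz`: entry
number `k` stands for the triple `(src[k], dst[k], siz[k])`.  The array `cnt` of length `1` holds
the number of triples found so far. -/

/-- The numbers of the working arrays. -/
abbrev cnt : ℕ := 0
abbrev src : ℕ := 1
abbrev dst : ℕ := 2
abbrev siz : ℕ := 3
abbrev acc : ℕ := 4

/-- The recursive procedure of two adjacent vertices `u`, `v`: it returns the number `s` of vertices
of the subtree of `v` with respect to the root `u`, and it adds the triples `(a, b, s_a(b))` and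
`(b, a, s_b(a))` to `S` for the edge `ab = uv` and for every edge `ab` of that subtree.

Local variables: `0 = u`, `1 = v`, `2 = s`, `3 = i`, `4 = w`, `5 = r`, `6 = k`.
```
s := 1
for w in the neighbours of v:
  if w ≠ u:
    r := sizes(v, w)
    s := s + r
S := S ∪ {(u, v, s), (v, u, n - s)}
return s
``` -/
def sizesProc : Proc where
  locals := 7
  body :=
    [ .assign 2 (.lit 1),
      .assign 3 (.lit 0),
      .loop (.lt (.var 3) (.deg (.var 1)))
        [ .assign 4 (.nbr (.var 1) (.var 3)),
          .cond (.ne (.var 4) (.var 0))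
            [ .call 5 0 [.var 1, .var 4],
              .assign 2 (.add (.var 2) (.var 5)) ],
          .assign 3 (.add (.var 3) (.lit 1)) ],
      .assign 6 (.get cnt (.lit 0)),
      .store src (.var 6) (.var 0),
      .store dst (.var 6) (.var 1),
      .store siz (.var 6) (.var 2),
      .assign 6 (.add (.var 6) (.lit 1)),
      .store src (.var 6) (.var 1),
      .store dst (.var 6) (.var 0),
      .store siz (.var 6) (.sub .size (.var 2)),
      .assign 6 (.add (.var 6) (.lit 1)),
      .store cnt (.lit 0) (.var 6),
      .ret (.var 2) ]

/-- The main procedure.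

Local variables: `0 = i`, `1 = w`, `2 = r`, `3 = k`, `4 = u`, `5 = t`, `6` and `7` for the result.
```
S := ∅
for w in the neighbours of the vertex 0:
  r := sizes(0, w)
L := a vector of n zeros                           (the array acc)
for (u, v, s) in S:
  L[u] := L[u] + s ^ 2
t := sum over all vertices u of (2 deg u - 1) L[u]
return ((n - 1) (3 n ^ 2 + 2 n - 2) - t) / (6 n)
``` -/
def mainProc : Proc where
  locals := 8
  body :=
    [ .alloc cnt (.lit 1),
      .alloc src (.mul (.lit 2) (.sub .size (.lit 1))),
      .alloc dst (.mul (.lit 2) (.sub .size (.lit 1))),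
      .alloc siz (.mul (.lit 2) (.sub .size (.lit 1))),
      .assign 0 (.lit 0),
      .loop (.lt (.var 0) (.deg (.lit 0)))
        [ .assign 1 (.nbr (.lit 0) (.var 0)),
          .call 2 0 [.lit 0, .var 1],
          .assign 0 (.add (.var 0) (.lit 1)) ],
      .alloc acc .size,
      .assign 3 (.lit 0),
      .loop (.lt (.var 3) (.get cnt (.lit 0)))
        [ .assign 4 (.get src (.var 3)),
          .store acc (.var 4)
            (.add (.get acc (.var 4)) (.mul (.get siz (.var 3)) (.get siz (.var 3)))),
          .assign 3 (.add (.var 3) (.lit 1)) ],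
      .assign 4 (.lit 0),
      .assign 5 (.lit 0),
      .loop (.lt (.var 4) .size)
        [ .assign 5
            (.add (.var 5)
              (.mul (.sub (.mul (.lit 2) (.deg (.var 4))) (.lit 1)) (.get acc (.var 4)))),
          .assign 4 (.add (.var 4) (.lit 1)) ],
      .assign 6
        (.sub
          (.mul (.sub .size (.lit 1))
            (.sub
              (.add (.mul (.lit 3) (.mul .size .size)) (.mul (.lit 2) .size))
              (.lit 2)))
          (.var 5)),
      .assign 7 (.mul (.lit 6) .size) ]

/-- The algorithm: it computes all directional subtree sizes and evaluates
`(n - 1) (3 n ^ 2 + 2 n - 2) / (6 n) - (1 / (6 n)) ∑ v, (2 deg v - 1) ∑ u ∈ N(v), s_v(u) ^ 2`. -/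
def computeExpectedPlanar : Program where
  procs := [sizesProc]
  arrays := 5
  main := mainProc
  num := 6
  den := 7

end PlanarSum

/-!
Let `u` and `v` be adjacent in the tree `G` and let `d` be the length of the edge `uv` in a planar
arrangement. Cyclic shifts preserve planarity, and over the `n` shifts of an arrangement the length
is `d` in `n - d` of them and `n - d` in the other `d`, so the mean of the length is the mean of
`2 * d * (n - d) / n`. Now `2 * (d - 1) * (n - d - 1)` is the number of the ordered pairs `(x, y)`
that the chord `uv` separates on the circle, so only the probability that `uv` separates `x` from
`y` is needed. Separation is invariant under cyclic shifts, so `u` may be assumed to come first.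
Each branch at `u` then occupies consecutive positions, and the branches may be permuted at will:
the probability is `0` for `x` and `y` in the same branch at `u` other than that of `v`, `1 / 3` in
two such branches, by the symmetry between these and the branch of `v`, and `1 / 2` if exactly one
of `x` and `y` is in the branch of `v`, by the exchange of the two branches. Counting pairs turns
the expected edge length into a polynomial in the sizes of the branches at `u` and at `v`; in the
sum over all edges these sizes occur only squared.

The running time is charged to the vertices: the call `sizes(u, v)` takes time proportional to
`s_u(v)`, by induction on `s_u(v)`, which is one more than the sum of the sizes for the recursive
calls. Each unit of time takes at most a bounded number of new words, which bounds the space.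
-/

namespace PlanarSum

section Darts

variable {V : Type*} {G : SimpleGraph V} [Fintype V] [DecidableRel G.Adj] {M : Type*}
  [AddCommMonoid M]

theorem sum_neighborFinset_comm (f : V → V → M) :
    ∑ u, ∑ w ∈ G.neighborFinset u, f u w = ∑ u, ∑ w ∈ G.neighborFinset u, f w u :=
  Finset.sum_comm' fun u w => by simp [G.adj_comm]

theorem sum_neighborFinset_edge (f : Sym2 V → M) :
    ∑ u, ∑ w ∈ G.neighborFinset u, f s(u, w) = 2 • ∑ e ∈ G.edgeFinset, f e := by
  classical
  have hdart : ∑ u, ∑ w ∈ G.neighborFinset u, f s(u, w) = ∑ d : G.Dart, f d.edge := by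
    rw [← Finset.sum_fiberwise (g := fun d : G.Dart => d.fst) (s := Finset.univ)]
    refine Finset.sum_congr rfl fun u _ => ?_
    rw [G.dart_fst_fiber u, Finset.sum_image fun _ _ _ _ h => G.dartOfNeighborSet_injective u h]
    exact Finset.sum_subtype _ (fun w => by simp) fun w => f s(u, w)
  rw [hdart, ← Finset.sum_fiberwise_of_maps_to (g := fun d : G.Dart => d.edge)
    (fun d _ => SimpleGraph.mem_edgeFinset.2 d.edge_mem), Finset.smul_sum]
  refine Finset.sum_congr rfl fun e he => ?_
  rw [Finset.sum_congr rfl fun d hd => congrArg f (Finset.mem_filter.1 hd).2, Finset.sum_const]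
  congr 1
  exact G.dart_edge_fiber_card e (SimpleGraph.mem_edgeFinset.1 he)

theorem sum_degree (hG : G.IsTree) :
    ∑ u, (G.degree u : ℤ) = 2 * (Fintype.card V - 1) := by
  rw [← Nat.cast_sum, G.sum_degrees_eq_twice_card_edges, ← hG.card_edgeFinset]
  push_cast
  ring

end Darts

/-! ### Branches of a tree -/

section Tree

variable {V : Type*} {G : SimpleGraph V}

open Classical in
/-- The first vertex after `u` on a path from `u` to `x`. It is `u` itself if `x = u`, and also if
there is no such path. -/
noncomputable def toward (G : SimpleGraph V) (u x : V) : V :=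
  if h : ∃ p : G.Walk u x, p.IsPath then h.choose.snd else u

theorem toward_self (u : V) : toward G u u = u := by
  have h : ∃ p : G.Walk u u, p.IsPath := ⟨.nil, .nil⟩
  rw [toward, dif_pos h, (SimpleGraph.Walk.isPath_iff_nil.1 h.choose_spec).eq_nil]
  rfl

theorem adj_toward (hG : G.Connected) {u x : V} (h : x ≠ u) : G.Adj u (toward G u x) := by
  classical
  have hp : ∃ p : G.Walk u x, p.IsPath := (hG.preconnected u x).exists_isPath
  rw [toward, dif_pos hp]
  exact hp.choose.adj_snd (SimpleGraph.Walk.not_nil_of_ne h.symm)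

theorem toward_ne_self (hG : G.Connected) {u x : V} (h : x ≠ u) : toward G u x ≠ u :=
  (adj_toward hG h).ne'

theorem toward_eq_snd (hG : G.IsAcyclic) {u x : V} {p : G.Walk u x} (hp : p.IsPath) :
    toward G u x = p.snd := by
  have h : ∃ p : G.Walk u x, p.IsPath := ⟨p, hp⟩
  have hpath : (⟨h.choose, h.choose_spec⟩ : G.Path u x) = ⟨p, hp⟩ :=
    (hG.subsingleton_path u x).elim _ _
  rw [toward, dif_pos h, show h.choose = p from congrArg Subtype.val hpath]

theorem toward_of_adj (hG : G.IsAcyclic) {u w : V} (h : G.Adj u w) : toward G u w = w :=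
  toward_eq_snd hG (SimpleGraph.Walk.IsPath.of_adj h)

theorem toward_congr (hG : G.IsTree) {u x y : V} (h : G.Adj x y) (hx : x ≠ u) (hy : y ≠ u) :
    toward G u x = toward G u y := by
  classical
  obtain ⟨p, hp, -⟩ := hG.existsUnique_path u x
  rw [toward_eq_snd hG.isAcyclic hp]
  cases p with
  | nil => exact absurd rfl hx
  | cons huw q =>
    rw [SimpleGraph.Walk.cons_isPath_iff] at hp
    have hu : u ∉ (q.concat h).bypass.support := fun hu => by
      have hu := (q.concat h).support_bypass_subset_support hu
      rw [SimpleGraph.Walk.support_concat, List.mem_append, List.mem_singleton] at hu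
      exact hu.elim hp.2 hy.symm
    rw [toward_eq_snd hG.isAcyclic
      ((SimpleGraph.Walk.cons_isPath_iff huw _).2 ⟨SimpleGraph.Walk.bypass_isPath _, hu⟩)]
    simp only [SimpleGraph.Walk.snd_cons]

theorem toward_eq_iff_of_adj (hG : G.IsTree) {u v x y : V} (huv : G.Adj u v) (hxy : G.Adj x y)
    (h : s(x, y) ≠ s(u, v)) : toward G u x = v ↔ toward G u y = v := by
  rw [Ne, Sym2.eq_iff, not_or] at h
  by_cases hx : x = u
  · subst hx
    rw [toward_self, toward_of_adj hG.isAcyclic hxy]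
    exact ⟨fun e => absurd e huv.ne, fun e => absurd ⟨rfl, e⟩ h.1⟩
  by_cases hy : y = u
  · subst hy
    rw [toward_self, toward_of_adj hG.isAcyclic hxy.symm]
    exact ⟨fun e => absurd ⟨e, rfl⟩ h.2, fun e => absurd e huv.ne⟩
  rw [toward_congr hG hxy hx hy]

theorem toward_eq_iff_ne (hG : G.IsTree) {u v : V} (huv : G.Adj u v) (x : V) :
    toward G u x = v ↔ toward G v x ≠ u := by
  have hu : toward G u u = v ↔ toward G v u ≠ u := by
    simp [toward_self, toward_of_adj hG.isAcyclic huv.symm, huv.ne]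
  have hv : toward G u v = v ↔ toward G v v ≠ u := by
    simp [toward_self, toward_of_adj hG.isAcyclic huv, huv.ne']
  induction (G.reachable_iff_reflTransGen u x).1 (hG.connected.preconnected u x) with
  | refl => exact hu
  | @tail s t _ hst hs =>
    by_cases htu : t = u
    · exact htu ▸ hu
    by_cases htv : t = v
    · exact htv ▸ hv
    have hne : s(s, t) ≠ s(u, v) := by simp [htu, htv]
    have hne' : s(s, t) ≠ s(v, u) := by rwa [Sym2.eq_swap (a := v)]
    exact ((toward_eq_iff_of_adj hG huv hst hne).symm.trans hs).trans
      (toward_eq_iff_of_adj hG huv.symm hst hne').not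

variable [Fintype V] [DecidableEq V]

/-- The vertices of the subtree of `v` when the tree is rooted at `u`, for adjacent `u` and `v`. -/
noncomputable def branch (G : SimpleGraph V) (u v : V) : Finset V :=
  Finset.univ.filter fun x => toward G u x = v

/-- The directional subtree size `s_u(v)`. -/
noncomputable def dirSize (G : SimpleGraph V) (u v : V) : ℕ := (branch G u v).card

theorem mem_branch {u v x : V} : x ∈ branch G u v ↔ toward G u x = v := by simp [branch]

theorem branch_swap (hG : G.IsTree) {u v : V} (h : G.Adj u v) :
    branch G v u = (branch G u v)ᶜ := by
  ext x
  simp [mem_branch, toward_eq_iff_ne hG h]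

theorem dirSize_add_dirSize (hG : G.IsTree) {u v : V} (h : G.Adj u v) :
    dirSize G u v + dirSize G v u = Fintype.card V := by
  rw [dirSize, dirSize, branch_swap hG h, Finset.card_add_card_compl]

theorem dirSize_le (G : SimpleGraph V) (u v : V) : dirSize G u v ≤ Fintype.card V :=
  Finset.card_le_univ _

theorem dirSize_pos (hG : G.IsAcyclic) {u v : V} (h : G.Adj u v) : 0 < dirSize G u v :=
  Finset.card_pos.2 ⟨v, mem_branch.2 (toward_of_adj hG h)⟩

theorem pairwise_disjoint_branch (G : SimpleGraph V) (u : V) :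
    Pairwise (Function.onFun Disjoint (branch G u)) := fun _ _ hvw =>
  Finset.disjoint_left.2 fun _ hv hw => hvw ((mem_branch.1 hv).symm.trans (mem_branch.1 hw))

variable [DecidableRel G.Adj]

theorem biUnion_branch (hG : G.Connected) (u : V) :
    (G.neighborFinset u).biUnion (branch G u) = Finset.univ.erase u := by
  ext x
  simp only [Finset.mem_biUnion, SimpleGraph.mem_neighborFinset, mem_branch, Finset.mem_erase,
    Finset.mem_univ, and_true]
  refine ⟨?_, fun hx => ⟨_, adj_toward hG hx, rfl⟩⟩
  rintro ⟨w, huw, rfl⟩ rfl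
  exact huw.ne (toward_self x).symm

theorem branch_eq_insert_biUnion (hG : G.IsTree) {u v : V} (h : G.Adj u v) :
    branch G u v = insert v (((G.neighborFinset v).erase u).biUnion (branch G v)) := by
  ext x
  simp only [mem_branch, toward_eq_iff_ne hG h, Finset.mem_insert, Finset.mem_biUnion,
    Finset.mem_erase, SimpleGraph.mem_neighborFinset]
  constructor
  · intro hx
    by_cases hxv : x = v
    · exact .inl hxv
    · exact .inr ⟨_, ⟨hx, adj_toward hG.connected hxv⟩, rfl⟩
  · rintro (rfl | ⟨w, ⟨hw, -⟩, rfl⟩)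
    · rw [toward_self]; exact h.ne'
    · exact hw

variable {M : Type*} [AddCommMonoid M]

theorem sum_branches (hG : G.Connected) (f : V → M) (u : V) :
    ∑ w ∈ G.neighborFinset u, ∑ x ∈ branch G u w, f x = ∑ x ∈ Finset.univ.erase u, f x := by
  rw [← biUnion_branch hG, Finset.sum_biUnion ((pairwise_disjoint_branch G u).set_pairwise _)]

theorem sum_branch (hG : G.IsTree) (f : V → M) {u v : V} (h : G.Adj u v) :
    ∑ x ∈ branch G u v, f x =
      f v + ∑ w ∈ (G.neighborFinset v).erase u, ∑ x ∈ branch G v w, f x := by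
  have hv : v ∉ ((G.neighborFinset v).erase u).biUnion (branch G v) := by
    simp only [Finset.mem_biUnion, mem_branch, toward_self, Finset.mem_erase]
    rintro ⟨w, ⟨-, hw⟩, rfl⟩
    exact G.irrefl ((G.mem_neighborFinset _ _).1 hw)
  rw [branch_eq_insert_biUnion hG h, Finset.sum_insert hv,
    Finset.sum_biUnion ((pairwise_disjoint_branch G v).set_pairwise _)]

theorem dirSize_eq (hG : G.IsTree) {u v : V} (h : G.Adj u v) :
    dirSize G u v = 1 + ∑ w ∈ (G.neighborFinset v).erase u, dirSize G v w := by
  simpa only [dirSize, Finset.card_eq_sum_ones] using sum_branch hG (fun _ => 1) h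

theorem sum_dirSize (hG : G.Connected) (u : V) :
    ∑ w ∈ G.neighborFinset u, dirSize G u w = Fintype.card V - 1 := by
  rw [← Finset.card_univ, ← Finset.card_erase_of_mem (Finset.mem_univ u),
    Finset.card_eq_sum_ones, ← sum_branches hG]
  simp [dirSize]

theorem sum_parent (hG : G.IsTree) (r : V) (f : V → V → M) :
    ∑ u, ∑ w ∈ G.neighborFinset u, (if toward G u r = w then f u w else 0) =
      ∑ u ∈ Finset.univ.erase r, f u (toward G u r) := by
  have hu : ∀ u, u ≠ r → ∑ w ∈ G.neighborFinset u, (if toward G u r = w then f u w else 0) =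
      f u (toward G u r) := fun u hu => by
    rw [Finset.sum_ite_eq, if_pos]
    exact (G.mem_neighborFinset _ _).2 (adj_toward hG.connected hu.symm)
  have hr : ∑ w ∈ G.neighborFinset r, (if toward G r r = w then f r w else 0) = 0 := by
    simp [toward_self]
  rw [← Finset.sum_erase Finset.univ (a := r) hr]
  exact Finset.sum_congr rfl fun u h => hu u (Finset.ne_of_mem_erase h)

theorem sum_neighborFinset_eq_sum_parent (hG : G.IsTree) (r : V) (f : V → V → M) :
    ∑ u, ∑ w ∈ G.neighborFinset u, f u w =
      ∑ u ∈ Finset.univ.erase r, (f u (toward G u r) + f (toward G u r) u) := by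
  have hsplit : ∀ u, ∀ w ∈ G.neighborFinset u, f u w =
      (if toward G u r = w then f u w else 0) + if toward G w r = u then f u w else 0 := by
    intro u w hw
    have h := toward_eq_iff_ne hG ((G.mem_neighborFinset _ _).1 hw) r
    by_cases hwr : toward G w r = u <;> simp [h, hwr]
  rw [Finset.sum_congr rfl fun u _ => Finset.sum_congr rfl (hsplit u)]
  simp only [Finset.sum_add_distrib]
  rw [sum_neighborFinset_comm fun u w => if toward G w r = u then f u w else 0, sum_parent hG,
    sum_parent hG r fun u w => f w u]

end Tree

/-! ### Symmetries of the planar arrangements of a tree -/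

section Arrangements

variable {n : ℕ}

theorem exists_perm_lt_iff {α : Type*} [LinearOrder α] {f : Fin n → α}
    (hf : Function.Injective f) : ∃ π : Arrangement n, ∀ x y, π x < π y ↔ f x < f y := by
  have h : StrictMono (f ∘ Tuple.sort f) :=
    (Tuple.monotone_sort f).strictMono_of_injective (hf.comp (Tuple.sort f).injective)
  refine ⟨(Tuple.sort f).symm, fun x y => ?_⟩
  rw [← h.lt_iff_lt]
  simp

theorem arrangement_eq_of_lt_iff {π τ : Arrangement n} (h : ∀ x y, π x < π y ↔ τ x < τ y) :
    π = τ := by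
  have hmono : StrictMono (π.symm.trans τ) := fun a b hab => by simpa [← h] using hab
  have hid : ⇑(π.symm.trans τ) = id :=
    hmono.range_inj strictMono_id |>.1 (by simp)
  ext x
  simpa using congrArg Fin.val (congrFun hid (π x)).symm

theorem val_eq_zero_iff_forall_lt (π : Arrangement n) (u : Fin n) :
    (π u : ℕ) = 0 ↔ ∀ x, x ≠ u → π u < π x := by
  constructor
  · intro h x hx
    have hne : π x ≠ π u := π.injective.ne hx
    omega
  · intro h
    by_contra h0
    have hlt := h (π.symm ⟨0, u.pos⟩) fun e => h0 (by simp [← e])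
    simp [Fin.lt_def] at hlt

theorem lt_of_val_eq_zero {π : Arrangement n} {u x : Fin n} (hu : (π u : ℕ) = 0) (hx : x ≠ u) :
    π u < π x :=
  (val_eq_zero_iff_forall_lt π u).1 hu x hx

/-- The position of `x` lies strictly between the positions of `u` and `v`. -/
def Between (π : Arrangement n) (u v x : Fin n) : Prop :=
  (π u < π x ∧ π x < π v) ∨ (π v < π x ∧ π x < π u)

/-- The chord `uv` separates `x` from `y` when the positions are placed on a circle. -/
def Separates (π : Arrangement n) (u v x y : Fin n) : Prop :=
  (x ≠ u ∧ x ≠ v ∧ y ≠ u ∧ y ≠ v) ∧ (Between π u v x ↔ ¬ Between π u v y)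

theorem separates_comm {π : Arrangement n} {u v x y : Fin n} :
    Separates π u v x y ↔ Separates π u v y x := by
  grind [Separates]

theorem separates_swap {π : Arrangement n} {u v x y : Fin n} :
    Separates π u v x y ↔ Separates π v u x y := by
  grind [Separates, Between]

theorem separates_iff_of_val_eq_zero {π : Arrangement n} {u v x y : Fin n} (hu : (π u : ℕ) = 0)
    (hxu : x ≠ u) (hxv : x ≠ v) (hyu : y ≠ u) (hyv : y ≠ v) :
    Separates π u v x y ↔ (π x < π v ↔ π v < π y) := by
  have hx := lt_of_val_eq_zero hu hxu
  have hy := lt_of_val_eq_zero hu hyu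
  have hyv' : π y ≠ π v := π.injective.ne hyv
  simp only [Separates, Between, ne_eq, hxu, hxv, hyu, hyv, not_false_eq_true, true_and]
  omega

variable {G : SimpleGraph (Fin n)}

theorem mem_planarArrangements {π : Arrangement n} :
    π ∈ planarArrangements G ↔ IsPlanar G π := by simp [planarArrangements]

/-- The planar arrangements in which `u` comes first. -/
noncomputable def planarFrom (G : SimpleGraph (Fin n)) (u : Fin n) : Finset (Arrangement n) :=
  (planarArrangements G).filter fun π => (π u : ℕ) = 0

theorem mem_planarFrom {u : Fin n} {π : Arrangement n} :
    π ∈ planarFrom G u ↔ IsPlanar G π ∧ (π u : ℕ) = 0 := by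
  simp [planarFrom, mem_planarArrangements]

theorem between_iff_of_adj {π : Arrangement n} (hπ : IsPlanar G π) {s t y z : Fin n}
    (hst : G.Adj s t) (hyz : G.Adj y z) (hys : y ≠ s) (hyt : y ≠ t) (hzs : z ≠ s) (hzt : z ≠ t) :
    Between π s t y ↔ Between π s t z := by
  have h₁ := hπ s t y z hst hyz
  have h₂ := hπ s t z y hst hyz.symm
  have h₃ := hπ t s y z hst.symm hyz
  have h₄ := hπ t s z y hst.symm hyz.symm
  have h₅ := hπ y z s t hyz hst
  have h₆ := hπ z y s t hyz.symm hst
  have h₇ := hπ y z t s hyz hst.symm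
  have h₈ := hπ z y t s hyz.symm hst.symm
  have hys := π.injective.ne hys
  have hyt := π.injective.ne hyt
  have hzs := π.injective.ne hzs
  have hzt := π.injective.ne hzt
  unfold Between
  omega

theorem between_iff_between_toward (hG : G.IsTree) {π : Arrangement n} (hπ : IsPlanar G π)
    {u s t x : Fin n} (hst : G.Adj s t) (hx : x ≠ u) (hs : toward G u s ≠ toward G u x)
    (ht : toward G u t ≠ toward G u x) :
    Between π s t x ↔ Between π s t (toward G u x) := by
  induction (G.reachable_iff_reflTransGen u x).1 (hG.connected.preconnected u x) with
  | refl => exact absurd rfl hx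
  | @tail a b _ hab ih =>
    by_cases ha : a = u
    · rw [toward_of_adj hG.isAcyclic (ha ▸ hab)]
    have hba := toward_congr hG hab ha hx
    rw [← hba] at hs ht ⊢
    rw [← ih ha hs ht]
    refine between_iff_of_adj hπ hst hab.symm ?_ ?_ ?_ ?_ <;> rintro rfl
    exacts [hs hba.symm, ht hba.symm, hs rfl, ht rfl]

theorem not_between_of_toward_ne (hG : G.IsTree) {π : Arrangement n} (hπ : IsPlanar G π)
    {u x y z : Fin n} (hu : (π u : ℕ) = 0) (hy : y ≠ u) (hyz : toward G u y = toward G u z)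
    (hx : toward G u x ≠ toward G u y) : ¬ Between π y z x := by
  have hu' : ¬ Between π y z u := by unfold Between; omega
  induction (G.reachable_iff_reflTransGen u x).1 (hG.connected.preconnected u x) with
  | refl => exact hu'
  | @tail s t _ hst ih =>
    by_cases htu : t = u
    · exact htu ▸ hu'
    have hs : toward G u s ≠ toward G u y := by
      by_cases hsu : s = u
      · rw [hsu, toward_self]; exact (toward_ne_self hG.connected hy).symm
      · rwa [toward_congr hG hst hsu htu]
    have hz : z ≠ u := by
      rintro rfl
      exact toward_ne_self hG.connected hy (hyz.trans (toward_self z))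
    have hyt := between_iff_between_toward hG hπ hst hy hs hx
    have hzt := between_iff_between_toward hG hπ hst hz (hyz ▸ hs) (hyz ▸ hx)
    rw [← hyz, ← hyt] at hzt
    have hne : ∀ {a b}, toward G u a ≠ toward G u b → π b ≠ π a := fun h e =>
      h (by rw [π.injective e])
    have hys := hne hs
    have hyt := hne hx
    have hzs := hne (hyz ▸ hs)
    have hzt := hne (hyz ▸ hx)
    have ih := ih hs
    unfold Between at *
    omega

theorem toward_lt_of_lt (hG : G.IsTree) {π : Arrangement n} (hπ : IsPlanar G π)
    {u x y : Fin n} (hu : (π u : ℕ) = 0) (hxy : toward G u x ≠ toward G u y) (h : π x < π y) :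
    π (toward G u x) < π (toward G u y) := by
  have hyu : y ≠ u := by rintro rfl; omega
  by_cases hxu : x = u
  · rw [hxu, toward_self]
    exact lt_of_val_eq_zero hu (toward_ne_self hG.connected hyu)
  have hx := toward_of_adj hG.isAcyclic (adj_toward hG.connected hxu)
  have hy := toward_of_adj hG.isAcyclic (adj_toward hG.connected hyu)
  have hbx := not_between_of_toward_ne hG hπ hu hyu hy.symm hxy
  have hby := not_between_of_toward_ne (x := toward G u y) hG hπ hu hxu hx.symm
    (by rw [hy]; exact hxy.symm)
  have hne₁ : π x ≠ π (toward G u y) := fun e => hxy (by rw [π.injective e, hy])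
  have hne₂ := π.injective.ne hxy
  unfold Between at hbx hby
  omega

/-- Each branch at the first vertex occupies consecutive positions. -/
theorem lt_iff_toward_lt (hG : G.IsTree) {π : Arrangement n} (hπ : IsPlanar G π)
    {u x y : Fin n} (hu : (π u : ℕ) = 0) (hxy : toward G u x ≠ toward G u y) :
    π x < π y ↔ π (toward G u x) < π (toward G u y) := by
  refine ⟨toward_lt_of_lt hG hπ hu hxy, fun h => ?_⟩
  by_contra hyx
  have hne : π x ≠ π y := fun e => hxy (by rw [π.injective e])
  exact h.not_gt (toward_lt_of_lt hG hπ hu hxy.symm (by omega))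

end Arrangements

section Regroup

variable {n : ℕ} {G : SimpleGraph (Fin n)}

theorem regroup_key_injective (G : SimpleGraph (Fin n)) (u : Fin n) (σ : Equiv.Perm (Fin n))
    (π : Arrangement n) :
    Function.Injective fun x => toLex (π (σ (toward G u x)), π x) :=
  fun _ _ h => π.injective (congrArg (fun p => (ofLex p).2) h)

/-- The arrangement that permutes the branches at `u` by `σ` and keeps the order within each of
them. -/
noncomputable def regroup (G : SimpleGraph (Fin n)) (u : Fin n) (σ : Equiv.Perm (Fin n))
    (π : Arrangement n) : Arrangement n :=
  (exists_perm_lt_iff (regroup_key_injective G u σ π)).choose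

theorem regroup_lt_iff {u : Fin n} {σ : Equiv.Perm (Fin n)} {π : Arrangement n} {x y : Fin n} :
    regroup G u σ π x < regroup G u σ π y ↔
      π (σ (toward G u x)) < π (σ (toward G u y)) ∨
        toward G u x = toward G u y ∧ π x < π y := by
  rw [regroup, (exists_perm_lt_iff (regroup_key_injective G u σ π)).choose_spec x y,
    Prod.Lex.toLex_lt_toLex]
  simp

theorem regroup_lt_iff_of_eq {u : Fin n} {σ : Equiv.Perm (Fin n)} {π : Arrangement n}
    {x y : Fin n} (h : toward G u x = toward G u y) :
    regroup G u σ π x < regroup G u σ π y ↔ π x < π y := by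
  simp [regroup_lt_iff, h]

theorem regroup_lt_iff_of_ne {u : Fin n} {σ : Equiv.Perm (Fin n)} {π : Arrangement n}
    {x y : Fin n} (h : toward G u x ≠ toward G u y) :
    regroup G u σ π x < regroup G u σ π y ↔
      π (σ (toward G u x)) < π (σ (toward G u y)) := by
  simp [regroup_lt_iff, h]

theorem regroup_lt_iff_of_adj (hG : G.IsAcyclic) {u v w : Fin n} {σ : Equiv.Perm (Fin n)}
    {π : Arrangement n} (hv : G.Adj u v) (hw : G.Adj u w) :
    regroup G u σ π v < regroup G u σ π w ↔ π (σ v) < π (σ w) := by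
  rw [regroup_lt_iff, toward_of_adj hG hv, toward_of_adj hG hw, or_iff_left]
  rintro ⟨rfl, h⟩
  exact h.false

theorem between_regroup (hG : G.IsAcyclic) {u a b c : Fin n} (σ : Equiv.Perm (Fin n))
    (π : Arrangement n) (ha : G.Adj u a) (hb : G.Adj u b) (hc : G.Adj u c) :
    Between (regroup G u σ π) a b c ↔ Between π (σ a) (σ b) (σ c) := by
  simp only [Between, regroup_lt_iff_of_adj hG, ha, hb, hc]

theorem regroup_val_eq_zero (hG : G.Connected) {u : Fin n} {σ : Equiv.Perm (Fin n)} (hσ : σ u = u)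
    {π : Arrangement n} (hu : (π u : ℕ) = 0) : (regroup G u σ π u : ℕ) = 0 := by
  rw [val_eq_zero_iff_forall_lt]
  intro x hx
  have hxu := toward_ne_self hG hx
  rw [regroup_lt_iff_of_ne (by rw [toward_self]; exact hxu.symm), toward_self, hσ]
  exact lt_of_val_eq_zero hu fun e => hxu (σ.injective (e.trans hσ.symm))

theorem isPlanar_regroup (hG : G.IsTree) {u : Fin n} {σ : Equiv.Perm (Fin n)} (hσ : σ u = u)
    {π : Arrangement n} (hπ : IsPlanar G π) (hu : (π u : ℕ) = 0) :
    IsPlanar G (regroup G u σ π) := by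
  rintro a c b d hac hbd ⟨hab, hbc, hcd⟩
  have hu' := regroup_val_eq_zero hG.connected hσ hu
  have hb : b ≠ u := by rintro rfl; omega
  have hc : c ≠ u := by rintro rfl; omega
  have hd : d ≠ u := by rintro rfl; omega
  have ebd := toward_congr hG hbd hb hd
  have ebc : toward G u b = toward G u c := by
    by_contra hne
    rw [regroup_lt_iff_of_ne hne] at hbc
    rw [regroup_lt_iff_of_ne (fun e => hne (ebd.trans e.symm)), ← ebd] at hcd
    exact hbc.not_gt hcd
  rw [regroup_lt_iff_of_eq ebc] at hbc
  rw [regroup_lt_iff_of_eq (ebc.symm.trans ebd)] at hcd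
  refine hπ a c b d hac hbd ⟨?_, hbc, hcd⟩
  by_cases ha : a = u
  · rw [ha]; exact lt_of_val_eq_zero hu hb
  · rwa [regroup_lt_iff_of_eq ((toward_congr hG hac ha hc).trans ebc.symm)] at hab

theorem regroup_regroup (hG : G.IsTree) {u : Fin n} {σ : Equiv.Perm (Fin n)} (hσ : σ u = u)
    (hadj : ∀ w, G.Adj u w → G.Adj u (σ w)) (hσσ : ∀ w, σ (σ w) = w)
    {π : Arrangement n} (hπ : IsPlanar G π) (hu : (π u : ℕ) = 0) :
    regroup G u σ (regroup G u σ π) = π := by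
  have ht : ∀ x, toward G u (σ (toward G u x)) = σ (toward G u x) := by
    intro x
    by_cases hx : x = u
    · rw [hx, toward_self, hσ, toward_self]
    · exact toward_of_adj hG.isAcyclic (hadj _ (adj_toward hG.connected hx))
  refine arrangement_eq_of_lt_iff fun x y => ?_
  by_cases h : toward G u x = toward G u y
  · rw [regroup_lt_iff_of_eq h, regroup_lt_iff_of_eq h]
  · rw [regroup_lt_iff_of_ne h, regroup_lt_iff_of_ne (by rw [ht, ht]; exact σ.injective.ne h),
      ht, ht, hσσ, hσσ, lt_iff_toward_lt hG hπ hu h]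

theorem card_filter_regroup (hG : G.IsTree) {u v w : Fin n} (hv : G.Adj u v) (hw : G.Adj u w)
    {p q : Arrangement n → Prop} [DecidablePred p] [DecidablePred q]
    (h : ∀ π ∈ planarFrom G u, p (regroup G u (Equiv.swap v w) π) ↔ q π) :
    ((planarFrom G u).filter p).card = ((planarFrom G u).filter q).card := by
  have hσ : Equiv.swap v w u = u := Equiv.swap_apply_of_ne_of_ne hv.ne hw.ne
  have hadj : ∀ x, G.Adj u x → G.Adj u (Equiv.swap v w x) := by
    intro x hx
    rw [Equiv.swap_apply_def]
    split_ifs <;> assumption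
  have hmem : ∀ π ∈ planarFrom G u, regroup G u (Equiv.swap v w) π ∈ planarFrom G u := by
    intro π hπ
    rw [mem_planarFrom] at hπ ⊢
    exact ⟨isPlanar_regroup hG hσ hπ.1 hπ.2, regroup_val_eq_zero hG.connected hσ hπ.2⟩
  have hinv : ∀ π ∈ planarFrom G u,
      regroup G u (Equiv.swap v w) (regroup G u (Equiv.swap v w) π) = π := by
    intro π hπ
    rw [mem_planarFrom] at hπ
    exact regroup_regroup hG hσ hadj (Equiv.swap_apply_self v w) hπ.1 hπ.2
  refine Finset.card_nbij' (regroup G u (Equiv.swap v w)) (regroup G u (Equiv.swap v w))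
    (fun π hπ => ?_) (fun π hπ => ?_) (fun π hπ => hinv π (Finset.mem_filter.1 hπ).1)
    (fun π hπ => hinv π (Finset.mem_filter.1 hπ).1)
  all_goals
    rw [Finset.mem_coe, Finset.mem_filter] at hπ ⊢
    refine ⟨hmem π hπ.1, ?_⟩
  · rw [← h _ (hmem π hπ.1), hinv π hπ.1]
    exact hπ.2
  · exact (h π hπ.1).2 hπ.2

end Regroup

section Rotate

variable {n : ℕ} [NeZero n] {G : SimpleGraph (Fin n)}

/-- The cyclic shift of an arrangement by `k` positions. -/
def rotate (k : Fin n) : Equiv.Perm (Arrangement n) := Equiv.mulLeft (Equiv.addRight k)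

theorem rotate_apply (k : Fin n) (π : Arrangement n) (x : Fin n) : rotate k π x = π x + k := rfl

theorem rotate_val (k : Fin n) (π : Arrangement n) (x : Fin n) :
    (rotate k π x : ℕ) = if n ≤ π x + k then (π x + k - n : ℕ) else (π x + k : ℕ) :=
  Fin.val_add_eq_ite _ _

theorem rotate_neg_rotate (k : Fin n) (π : Arrangement n) : rotate (-k) (rotate k π) = π := by
  ext x
  simp [rotate_apply]

theorem IsPlanar.rotate {π : Arrangement n} (hπ : IsPlanar G π) (k : Fin n) :
    IsPlanar G (rotate k π) := by
  rintro a c b d hac hbd h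
  simp only [Fin.lt_def, rotate_val] at h
  have h₁ := hπ a c b d hac hbd
  have h₂ := hπ b d c a hbd hac.symm
  have h₃ := hπ c a d b hac.symm hbd.symm
  have h₄ := hπ d b a c hbd.symm hac
  simp only [Fin.lt_def] at h₁ h₂ h₃ h₄
  split_ifs at h <;> omega

theorem isPlanar_rotate_iff {k : Fin n} {π : Arrangement n} :
    IsPlanar G (rotate k π) ↔ IsPlanar G π :=
  ⟨fun h => rotate_neg_rotate k π ▸ h.rotate (-k), fun h => h.rotate k⟩

theorem separates_rotate (k : Fin n) (π : Arrangement n) (u v x y : Fin n) :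
    Separates (rotate k π) u v x y ↔ Separates π u v x y := by
  unfold Separates
  refine and_congr_right fun ⟨hxu, hxv, hyu, hyv⟩ => ?_
  have hxu := Fin.val_ne_iff.2 (π.injective.ne hxu)
  have hxv := Fin.val_ne_iff.2 (π.injective.ne hxv)
  have hyu := Fin.val_ne_iff.2 (π.injective.ne hyu)
  have hyv := Fin.val_ne_iff.2 (π.injective.ne hyv)
  have hu := (π u).2
  have hv := (π v).2
  have hx := (π x).2
  have hy := (π y).2
  simp only [Between, Fin.lt_def, rotate_val]
  generalize (π u : ℕ) = a, (π v : ℕ) = b, (π x : ℕ) = c, (π y : ℕ) = d at *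
  split_ifs <;> omega

theorem card_filter_rotate (u : Fin n) {p : Arrangement n → Prop} [DecidablePred p]
    (hp : ∀ k π, p (rotate k π) ↔ p π) :
    ((planarArrangements G).filter p).card = n * ((planarFrom G u).filter p).card := by
  have hfiber : ∀ j ∈ Finset.univ,
      (((planarArrangements G).filter p).filter fun π => π u = j).card =
        ((planarFrom G u).filter p).card := fun j _ =>
    Finset.card_equiv (rotate (-j)) fun π => by
      simp only [Finset.mem_filter, mem_planarArrangements, mem_planarFrom, isPlanar_rotate_iff,
        hp, rotate_apply, Fin.val_eq_zero_iff, add_neg_eq_zero]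
      tauto
  rw [Finset.card_eq_sum_card_fiberwise (t := Finset.univ) (f := fun π : Arrangement n => π u)
    fun _ _ => Finset.mem_coe.2 (Finset.mem_univ _), Finset.sum_const_nat hfiber]
  simp

theorem sum_planarArrangements_rotate {M : Type*} [AddCommMonoid M] (k : Fin n)
    (f : Arrangement n → M) :
    ∑ π ∈ planarArrangements G, f (rotate k π) = ∑ π ∈ planarArrangements G, f π :=
  Finset.sum_equiv (rotate k)
    (fun π => by rw [mem_planarArrangements, mem_planarArrangements, isPlanar_rotate_iff])
    fun _ _ => rfl

end Rotate

/-! ### Edge lengths and separated pairs -/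

section Separation

variable {n : ℕ} {G : SimpleGraph (Fin n)}

open Classical in
/-- The number of the planar arrangements in which the chord `uv` separates `x` from `y`. -/
noncomputable def numSeparating (G : SimpleGraph (Fin n)) (u v x y : Fin n) : ℕ :=
  ((planarArrangements G).filter fun π => Separates π u v x y).card

theorem numSeparating_comm (u v x y : Fin n) :
    numSeparating G u v x y = numSeparating G u v y x := by
  classical
  exact congrArg Finset.card (Finset.filter_congr fun _ _ => separates_comm)

theorem numSeparating_swap (u v x y : Fin n) :
    numSeparating G u v x y = numSeparating G v u x y := by
  classical
  exact congrArg Finset.card (Finset.filter_congr fun _ _ => separates_swap)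

open Classical in
theorem numSeparating_eq (a u v x y : Fin n) :
    numSeparating G u v x y = n * ((planarFrom G a).filter fun π => Separates π u v x y).card := by
  have : NeZero n := .of_pos a.pos
  exact card_filter_rotate a fun k π => separates_rotate k π u v x y

theorem card_planarArrangements (u : Fin n) :
    (planarArrangements G).card = n * (planarFrom G u).card := by
  have : NeZero n := .of_pos u.pos
  simpa using card_filter_rotate (G := G) u (p := fun _ => True) fun _ _ => Iff.rfl

theorem separates_iff_between_toward (hG : G.IsTree) {π : Arrangement n} (hπ : IsPlanar G π)
    {u v x y : Fin n} (hu : (π u : ℕ) = 0) (hv : G.Adj u v) (hx : x ≠ u) (hy : y ≠ u)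
    (hxv : toward G u x ≠ v) (hyv : toward G u y ≠ v) :
    Separates π u v x y ↔ Between π (toward G u x) (toward G u y) v := by
  have htv := toward_of_adj hG.isAcyclic hv
  have hx_lt := lt_iff_toward_lt hG hπ hu (x := x) (y := v) (by rwa [htv])
  have hy_gt := lt_iff_toward_lt hG hπ hu (x := v) (y := y) (by rw [htv]; exact hyv.symm)
  rw [separates_iff_of_val_eq_zero hu hx (fun e => hxv (e ▸ htv)) hy (fun e => hyv (e ▸ htv)),
    hx_lt, hy_gt, htv]
  have hxv := π.injective.ne hxv
  have hyv := π.injective.ne hyv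
  unfold Between
  omega

theorem numSeparating_eq_zero (hG : G.IsTree) {u v x y : Fin n} (hv : G.Adj u v)
    (hxy : toward G u x = toward G u y) (hxv : toward G u x ≠ v) :
    numSeparating G u v x y = 0 := by
  classical
  rw [numSeparating_eq u, Finset.filter_false_of_mem, Finset.card_empty, mul_zero]
  intro π hπ hsep
  rw [mem_planarFrom] at hπ
  have hbetween := (separates_iff_between_toward hG hπ.1 hπ.2 hv hsep.1.1 hsep.1.2.2.1 hxv
    (hxy ▸ hxv)).1 hsep
  rw [hxy] at hbetween
  unfold Between at hbetween
  omega

open Classical in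
theorem three_mul_card_between (hG : G.IsTree) {u a b c : Fin n} (ha : G.Adj u a)
    (hb : G.Adj u b) (hc : G.Adj u c) (hab : a ≠ b) (hac : a ≠ c) (hbc : b ≠ c) :
    3 * ((planarFrom G u).filter fun π => Between π a b c).card = (planarFrom G u).card := by
  have hswap_ac : ((planarFrom G u).filter fun π => Between π a b c).card =
      ((planarFrom G u).filter fun π => Between π c b a).card :=
    card_filter_regroup hG ha hc fun π _ => by
      rw [between_regroup hG.isAcyclic _ _ ha hb hc, Equiv.swap_apply_left,
        Equiv.swap_apply_right, Equiv.swap_apply_of_ne_of_ne hab.symm hbc]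
  have hswap_bc : ((planarFrom G u).filter fun π => Between π a b c).card =
      ((planarFrom G u).filter fun π => Between π a c b).card :=
    card_filter_regroup hG hb hc fun π _ => by
      rw [between_regroup hG.isAcyclic _ _ ha hb hc, Equiv.swap_apply_left,
        Equiv.swap_apply_right, Equiv.swap_apply_of_ne_of_ne hab hac]
  have htotal : (planarFrom G u).card = ((planarFrom G u).filter fun π => Between π a b c).card +
      ((planarFrom G u).filter fun π => Between π c b a).card +
      ((planarFrom G u).filter fun π => Between π a c b).card := by
    simp only [Finset.card_filter, ← Finset.sum_add_distrib]
    rw [Finset.card_eq_sum_ones]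
    refine Finset.sum_congr rfl fun π _ => ?_
    have hab := π.injective.ne hab
    have hac := π.injective.ne hac
    have hbc := π.injective.ne hbc
    unfold Between
    split_ifs <;> omega
  omega

theorem three_mul_numSeparating (hG : G.IsTree) {u v x y : Fin n} (hv : G.Adj u v) (hx : x ≠ u)
    (hy : y ≠ u) (hxy : toward G u x ≠ toward G u y) (hxv : toward G u x ≠ v)
    (hyv : toward G u y ≠ v) :
    3 * numSeparating G u v x y = (planarArrangements G).card := by
  classical
  have hsep : ∀ π ∈ planarFrom G u,
      (Separates π u v x y ↔ Between π (toward G u x) (toward G u y) v) := fun π hπ =>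
    separates_iff_between_toward hG (mem_planarFrom.1 hπ).1 (mem_planarFrom.1 hπ).2 hv hx hy hxv
      hyv
  rw [numSeparating_eq u, card_planarArrangements u, mul_left_comm, Finset.filter_congr hsep,
    three_mul_card_between hG (adj_toward hG.connected hx) (adj_toward hG.connected hy) hv hxy
      hxv hyv]

theorem separates_regroup_swap_iff (hG : G.IsTree) {π : Arrangement n} (hπ : IsPlanar G π)
    {u v x y : Fin n} (hu : (π u : ℕ) = 0) (hv : G.Adj u v) (hxv : x ≠ v) (hyu : y ≠ u)
    (hx : toward G u x = v) (hy : toward G u y ≠ v) :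
    Separates (regroup G u (Equiv.swap v (toward G u y)) π) u v x y ↔
      ¬ Separates π u v x y := by
  have hw := adj_toward hG.connected hyu
  have htv := toward_of_adj hG.isAcyclic hv
  have hxu : x ≠ u := by rintro rfl; exact hv.ne ((toward_self x).symm.trans hx)
  have hyv : y ≠ v := by rintro rfl; exact hy htv
  have hσ : Equiv.swap v (toward G u y) u = u := Equiv.swap_apply_of_ne_of_ne hv.ne hw.ne
  have hu' := regroup_val_eq_zero hG.connected hσ hu
  have hvy : toward G u v ≠ toward G u y := by rw [htv]; exact hy.symm
  rw [separates_iff_of_val_eq_zero hu' hxu hxv hyu hyv,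
    separates_iff_of_val_eq_zero hu hxu hxv hyu hyv,
    regroup_lt_iff_of_eq (hx.trans htv.symm), regroup_lt_iff_of_ne hvy,
    lt_iff_toward_lt hG hπ hu hvy, htv, Equiv.swap_apply_left, Equiv.swap_apply_right]
  have hne := π.injective.ne hy
  omega

theorem two_mul_numSeparating (hG : G.IsTree) {u v x y : Fin n} (hv : G.Adj u v) (hxv : x ≠ v)
    (hyu : y ≠ u) (hx : toward G u x = v) (hy : toward G u y ≠ v) :
    2 * numSeparating G u v x y = (planarArrangements G).card := by
  classical
  have hhalf : ((planarFrom G u).filter fun π => Separates π u v x y).card =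
      ((planarFrom G u).filter fun π => ¬ Separates π u v x y).card :=
    card_filter_regroup hG hv (adj_toward hG.connected hyu) fun π hπ => by
      rw [mem_planarFrom] at hπ
      rw [separates_regroup_swap_iff hG hπ.1 hπ.2 hv hxv hyu hx hy]
  rw [numSeparating_eq u, card_planarArrangements u, mul_left_comm, two_mul]
  nth_rw 2 [hhalf]
  rw [Finset.card_filter_add_card_filter_not]

end Separation

section EdgeLength

variable {n : ℕ} {G : SimpleGraph (Fin n)}

theorem edgeLength_mk (π : Arrangement n) (u v : Fin n) :
    edgeLength π s(u, v) = |((π u : ℕ) : ℤ) - ((π v : ℕ) : ℤ)| := rfl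

theorem edgeLength_rotate [NeZero n] {π : Arrangement n} {u v : Fin n} (h : π v ≤ π u)
    (k : Fin n) :
    n * edgeLength (rotate k π) s(u, v) =
      (2 * edgeLength π s(u, v) - n) * (((rotate k π u : ℕ) : ℤ) - ((rotate k π v : ℕ) : ℤ)) +
        2 * (edgeLength π s(u, v) * (n - edgeLength π s(u, v))) := by
  obtain ⟨d, hd⟩ : ∃ d : ℤ, d = ((π u : ℕ) : ℤ) - ((π v : ℕ) : ℤ) := ⟨_, rfl⟩
  have hd₀ : 0 ≤ d := by omega
  have hdn : d ≤ n := by omega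
  have hdiff : ((rotate k π u : ℕ) : ℤ) - ((rotate k π v : ℕ) : ℤ) = d ∨
      ((rotate k π u : ℕ) : ℤ) - ((rotate k π v : ℕ) : ℤ) = d - n := by
    rw [rotate_val, rotate_val]
    split_ifs <;> omega
  rw [edgeLength_mk, edgeLength_mk, ← hd, abs_of_nonneg hd₀]
  rcases hdiff with h | h <;> rw [h]
  · rw [abs_of_nonneg hd₀]; ring
  · rw [abs_of_nonpos (by omega)]; ring

theorem sum_edgeLength_rotate [NeZero n] (π : Arrangement n) (u v : Fin n) :
    ∑ k, edgeLength (rotate k π) s(u, v) =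
      2 * (edgeLength π s(u, v) * (n - edgeLength π s(u, v))) := by
  wlog h : π v ≤ π u generalizing u v
  · rw [Sym2.eq_swap]
    exact this v u (le_of_not_ge h)
  have hsum : ∀ x : Fin n, ∑ k, ((rotate k π x : ℕ) : ℤ) = ∑ k : Fin n, ((k : ℕ) : ℤ) := fun x =>
    Equiv.sum_comp (Equiv.addLeft (π x)) fun k : Fin n => ((k : ℕ) : ℤ)
  have hn : (n : ℤ) ≠ 0 := by exact_mod_cast NeZero.ne n
  apply mul_left_cancel₀ hn
  rw [Finset.mul_sum, Finset.sum_congr rfl fun k _ => edgeLength_rotate h k,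
    Finset.sum_add_distrib, ← Finset.mul_sum, Finset.sum_sub_distrib, hsum, hsum]
  simp

theorem sum_edgeLength (G : SimpleGraph (Fin n)) (u v : Fin n) :
    n * ∑ π ∈ planarArrangements G, edgeLength π s(u, v) =
      ∑ π ∈ planarArrangements G, 2 * (edgeLength π s(u, v) * (n - edgeLength π s(u, v))) := by
  have : NeZero n := .of_pos u.pos
  simp only [← sum_edgeLength_rotate]
  rw [Finset.sum_comm, Finset.sum_congr rfl fun k _ =>
    sum_planarArrangements_rotate k fun π => edgeLength π s(u, v)]
  simp

open Classical in
theorem card_filter_between (π : Arrangement n) {u v : Fin n} (h : u ≠ v) :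
    ((Finset.univ.filter fun x => Between π u v x).card : ℤ) = edgeLength π s(u, v) - 1 := by
  have hmap : (Finset.univ.filter fun x => Between π u v x) =
      (Finset.Ioo (min (π u) (π v)) (max (π u) (π v))).map π.symm.toEmbedding := by
    ext x
    simp only [Finset.mem_filter_univ, Finset.mem_map_equiv, Equiv.symm_symm, Finset.mem_Ioo,
      inf_lt_iff, lt_sup_iff]
    unfold Between
    omega
  rw [hmap, Finset.card_map, Fin.card_Ioo, edgeLength_mk]
  rcases lt_or_gt_of_ne (π.injective.ne h) with hlt | hlt
  · rw [min_eq_left hlt.le, max_eq_right hlt.le, abs_of_neg (by omega)]; omega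
  · rw [min_eq_right hlt.le, max_eq_left hlt.le, abs_of_pos (by omega)]; omega

open Classical in
theorem card_filter_separates (π : Arrangement n) {u v : Fin n} (h : u ≠ v) :
    ((Finset.univ.filter fun p : Fin n × Fin n => Separates π u v p.1 p.2).card : ℤ) =
      2 * ((edgeLength π s(u, v) - 1) * (n - edgeLength π s(u, v) - 1)) := by
  set inside := Finset.univ.filter fun x => Between π u v x with hinside
  set outside := ({u, v} ∪ inside)ᶜ with houtside
  have hmem : ∀ x, x ∈ outside ↔ x ≠ u ∧ x ≠ v ∧ ¬ Between π u v x := by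
    simp [houtside, hinside]
  have hends : ∀ x, Between π u v x → x ≠ u ∧ x ≠ v := by
    unfold Between
    rintro x h
    constructor <;> rintro rfl <;> omega
  have hpairs : (Finset.univ.filter fun p : Fin n × Fin n => Separates π u v p.1 p.2) =
      inside ×ˢ outside ∪ outside ×ˢ inside := by
    ext ⟨x, y⟩
    simp only [Finset.mem_filter_univ, Finset.mem_union, Finset.mem_product, hmem, hinside]
    grind [Separates]
  have hdisj : Disjoint (inside ×ˢ outside) (outside ×ˢ inside) :=
    Finset.disjoint_product.2 (.inl (disjoint_compl_right.mono_left Finset.subset_union_right))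
  have hcard := Finset.card_compl_add_card ({u, v} ∪ inside)
  have huv : Disjoint {u, v} inside := Finset.disjoint_right.2 fun x hx => by
    simpa using hends x (Finset.mem_filter_univ x |>.1 hx)
  rw [← houtside, Finset.card_union_of_disjoint huv, Finset.card_pair h, Fintype.card_fin]
    at hcard
  rw [hpairs, Finset.card_union_of_disjoint hdisj, Finset.card_product, Finset.card_product,
    show (n : ℤ) = outside.card + (2 + inside.card) by exact_mod_cast hcard.symm,
    eq_add_of_sub_eq (card_filter_between π h).symm, ← hinside]
  push_cast
  ring

theorem sum_numSeparating (G : SimpleGraph (Fin n)) {u v : Fin n} (h : u ≠ v) :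
    ∑ x, ∑ y, (numSeparating G u v x y : ℤ) = ∑ π ∈ planarArrangements G,
      2 * ((edgeLength π s(u, v) - 1) * (n - edgeLength π s(u, v) - 1)) := by
  classical
  simp only [← card_filter_separates _ h, numSeparating, Finset.card_filter, Nat.cast_sum]
  rw [Finset.sum_comm (s := planarArrangements G), Fintype.sum_prod_type]

theorem sum_edgeLength_eq_sum_numSeparating (G : SimpleGraph (Fin n)) {u v : Fin n}
    (h : u ≠ v) :
    n * ∑ π ∈ planarArrangements G, edgeLength π s(u, v) =
      2 * (n - 1) * (planarArrangements G).card + ∑ x, ∑ y, (numSeparating G u v x y : ℤ) := by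
  rw [sum_numSeparating G h, sum_edgeLength, mul_comm, ← nsmul_eq_mul, ← Finset.sum_const,
    ← Finset.sum_add_distrib]
  refine Finset.sum_congr rfl fun π _ => ?_
  ring

end EdgeLength

/-! ### The expected sum of the edge lengths -/

section Side

variable {V : Type*} {G : SimpleGraph V} [Fintype V] [DecidableEq V]

/-- The vertices other than `u` on the side of `u` of an edge `uv`. -/
noncomputable def side (G : SimpleGraph V) (u v : V) : Finset V := (branch G v u).erase u

theorem mem_branch_self (hG : G.IsAcyclic) {u v : V} (h : G.Adj u v) : u ∈ branch G v u :=
  mem_branch.2 (toward_of_adj hG h.symm)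

theorem mem_side (hG : G.IsTree) {u v x : V} (h : G.Adj u v) :
    x ∈ side G u v ↔ x ≠ u ∧ toward G u x ≠ v := by
  rw [side, Finset.mem_erase, mem_branch, toward_eq_iff_ne hG h.symm]

theorem card_side (hG : G.IsAcyclic) {u v : V} (h : G.Adj u v) :
    ((side G u v).card : ℤ) = dirSize G v u - 1 := by
  rw [side, Finset.card_erase_of_mem (mem_branch_self hG h), ← dirSize,
    Nat.cast_sub (dirSize_pos hG h.symm), Nat.cast_one]

theorem sum_eq_sum_side_add_sum_side {M : Type*} [AddCommMonoid M] (hG : G.IsTree) {u v : V}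
    (h : G.Adj u v) {f : V → M} (hu : f u = 0) (hv : f v = 0) :
    ∑ x, f x = ∑ x ∈ side G u v, f x + ∑ x ∈ side G v u, f x := by
  rw [side, side, Finset.sum_erase _ hu, Finset.sum_erase _ hv, branch_swap hG h,
    Finset.sum_compl_add_sum]

variable [DecidableRel G.Adj]

theorem sum_side {M : Type*} [AddCancelCommMonoid M] (hG : G.IsTree) {u v : V} (h : G.Adj u v)
    (f : V → M) :
    ∑ x ∈ side G u v, f x = ∑ w ∈ (G.neighborFinset u).erase v, ∑ x ∈ branch G u w, f x := by
  refine add_left_cancel (a := f u) ?_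
  rw [side, Finset.add_sum_erase _ f (mem_branch_self hG.isAcyclic h), sum_branch hG f h.symm]

/-- The sum of the squares of the directional subtree sizes at `u`. -/
noncomputable def sumSq (G : SimpleGraph V) [DecidableRel G.Adj] (u : V) : ℤ :=
  ∑ w ∈ G.neighborFinset u, (dirSize G u w : ℤ) ^ 2

theorem sum_side_same_branch (hG : G.IsTree) {u v : V} (h : G.Adj u v) :
    ∑ x ∈ side G u v, ∑ y ∈ side G u v,
      (if toward G u x = toward G u y then (1 : ℤ) else 0) =
        sumSq G u - (dirSize G u v : ℤ) ^ 2 := by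
  have hbranch : ∀ w ∈ (G.neighborFinset u).erase v, ∀ x ∈ branch G u w,
      ∑ y ∈ side G u v, (if toward G u x = toward G u y then (1 : ℤ) else 0) =
        dirSize G u w := by
    intro w hw x hx
    rw [mem_branch] at hx
    rw [sum_side hG h, Finset.sum_eq_single_of_mem w hw]
    · rw [Finset.sum_congr rfl fun y hy => if_pos (hx.trans (mem_branch.1 hy).symm)]
      simp [dirSize]
    · intro w' _ hw'
      refine Finset.sum_eq_zero fun y hy => if_neg ?_
      rw [hx, mem_branch.1 hy]
      exact hw'.symm
  rw [sumSq, ← Finset.add_sum_erase _ _ ((G.mem_neighborFinset _ _).2 h), add_sub_cancel_left,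
    sum_side hG h]
  refine Finset.sum_congr rfl fun w hw => ?_
  rw [Finset.sum_congr rfl (hbranch w hw), Finset.sum_const, nsmul_eq_mul, dirSize, sq]

theorem sum_dirSize_mul_dirSize (hG : G.IsTree) :
    ∑ u, ∑ w ∈ G.neighborFinset u, (dirSize G u w : ℤ) * dirSize G w u =
      Fintype.card V * (Fintype.card V * (Fintype.card V - 1)) - ∑ u, sumSq G u := by
  have hcard : 1 ≤ Fintype.card V := Fintype.card_pos_iff.2 hG.connected.nonempty
  have hsize : ∀ u, ∑ w ∈ G.neighborFinset u, (dirSize G u w : ℤ) = Fintype.card V - 1 :=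
    fun u => by rw [← Nat.cast_sum, sum_dirSize hG.connected, Nat.cast_sub hcard, Nat.cast_one]
  have hmul : ∀ u, ∑ w ∈ G.neighborFinset u, (dirSize G u w : ℤ) * dirSize G w u =
      Fintype.card V * (Fintype.card V - 1) - sumSq G u := by
    intro u
    rw [← hsize u, Finset.mul_sum, sumSq, ← Finset.sum_sub_distrib]
    refine Finset.sum_congr rfl fun w hw => ?_
    rw [← dirSize_add_dirSize hG ((G.mem_neighborFinset _ _).1 hw)]
    push_cast
    ring
  rw [Finset.sum_congr rfl fun u _ => hmul u, Finset.sum_sub_distrib, Finset.sum_const,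
    Finset.card_univ, nsmul_eq_mul]

theorem sum_sumSq_add_sumSq (G : SimpleGraph V) [DecidableRel G.Adj] :
    ∑ u, ∑ w ∈ G.neighborFinset u, (sumSq G u + sumSq G w) =
      2 * ∑ u, (G.degree u : ℤ) * sumSq G u := by
  simp only [Finset.sum_add_distrib]
  rw [← sum_neighborFinset_comm fun u _ => sumSq G u, ← two_mul]
  simp [SimpleGraph.card_neighborFinset_eq_degree]

end Side

section EdgeSum

variable {n : ℕ} {G : SimpleGraph (Fin n)}

theorem numSeparating_eq_zero_of_mem_ends {u v x : Fin n} (h : x = u ∨ x = v) (y : Fin n) :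
    numSeparating G u v x y = 0 := by
  classical
  rw [numSeparating, Finset.card_eq_zero]
  exact Finset.filter_false_of_mem fun π _ hsep => h.elim hsep.1.1 hsep.1.2.1

theorem two_mul_sum_numSeparating_side_side (hG : G.IsTree) {u v : Fin n} (h : G.Adj u v) :
    2 * ∑ x ∈ side G u v, ∑ y ∈ side G v u, (numSeparating G u v x y : ℤ) =
      (planarArrangements G).card * (((dirSize G v u : ℤ) - 1) * ((dirSize G u v : ℤ) - 1)) := by
  have hpair : ∀ x ∈ side G u v, ∀ y ∈ side G v u,
      2 * (numSeparating G u v x y : ℤ) = (planarArrangements G).card := by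
    intro x hx y hy
    rw [side, Finset.mem_erase, mem_branch] at hx
    rw [mem_side hG h.symm] at hy
    rw [numSeparating_swap]
    exact_mod_cast two_mul_numSeparating hG h.symm hx.1 hy.1 hx.2 hy.2
  simp only [Finset.mul_sum]
  rw [Finset.sum_congr rfl fun x hx => Finset.sum_congr rfl (hpair x hx)]
  simp only [Finset.sum_const, nsmul_eq_mul, card_side hG.isAcyclic h,
    card_side hG.isAcyclic h.symm]
  ring

theorem sum_numSeparating_eq_sum_side (hG : G.IsTree) {u v : Fin n} (h : G.Adj u v) :
    ∑ x, ∑ y, (numSeparating G u v x y : ℤ) =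
      ∑ x ∈ side G u v, ∑ y ∈ side G u v, (numSeparating G u v x y : ℤ) +
        2 * ∑ x ∈ side G u v, ∑ y ∈ side G v u, (numSeparating G u v x y : ℤ) +
        ∑ x ∈ side G v u, ∑ y ∈ side G v u, (numSeparating G v u x y : ℤ) := by
  have hends : ∀ {x}, x = u ∨ x = v → ∀ y, (numSeparating G u v x y : ℤ) = 0 := fun hx y => by
    rw [numSeparating_eq_zero_of_mem_ends hx, Nat.cast_zero]
  have hrow : ∀ x, ∑ y, (numSeparating G u v x y : ℤ) =
      ∑ y ∈ side G u v, (numSeparating G u v x y : ℤ) +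
        ∑ y ∈ side G v u, (numSeparating G u v x y : ℤ) := fun x =>
    sum_eq_sum_side_add_sum_side hG h (by rw [numSeparating_comm, hends (.inl rfl)])
      (by rw [numSeparating_comm, hends (.inr rfl)])
  have hcross : ∑ x ∈ side G v u, ∑ y ∈ side G u v, (numSeparating G u v x y : ℤ) =
      ∑ x ∈ side G u v, ∑ y ∈ side G v u, (numSeparating G u v x y : ℤ) := by
    rw [Finset.sum_comm]
    simp only [numSeparating_comm u v]
  rw [sum_eq_sum_side_add_sum_side hG h (Finset.sum_eq_zero fun y _ => hends (.inl rfl) y)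
    (Finset.sum_eq_zero fun y _ => hends (.inr rfl) y)]
  simp only [hrow, Finset.sum_add_distrib, hcross, numSeparating_swap v u]
  ring

variable [DecidableRel G.Adj]

theorem three_mul_sum_numSeparating_side (hG : G.IsTree) {u v : Fin n} (h : G.Adj u v) :
    3 * ∑ x ∈ side G u v, ∑ y ∈ side G u v, (numSeparating G u v x y : ℤ) =
      (planarArrangements G).card *
        (((dirSize G v u : ℤ) - 1) ^ 2 - (sumSq G u - (dirSize G u v : ℤ) ^ 2)) := by
  have hpair : ∀ x ∈ side G u v, ∀ y ∈ side G u v, 3 * (numSeparating G u v x y : ℤ) =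
      (planarArrangements G).card * (1 - if toward G u x = toward G u y then 1 else 0) := by
    intro x hx y hy
    rw [mem_side hG h] at hx hy
    split_ifs with hxy
    · simp [numSeparating_eq_zero hG h hxy hx.2]
    · rw [sub_zero, mul_one]
      exact_mod_cast three_mul_numSeparating hG h hx.1 hy.1 hxy hx.2 hy.2
  simp only [Finset.mul_sum]
  rw [Finset.sum_congr rfl fun x hx => Finset.sum_congr rfl (hpair x hx)]
  simp only [← Finset.mul_sum, Finset.sum_sub_distrib]
  rw [sum_side_same_branch hG h]
  simp only [Finset.sum_const, nsmul_eq_mul, card_side hG.isAcyclic h]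
  ring

theorem three_mul_sum_edgeLength (hG : G.IsTree) {u v : Fin n} (h : G.Adj u v) :
    3 * (n * ∑ π ∈ planarArrangements G, edgeLength π s(u, v)) =
      (planarArrangements G).card * (2 * n ^ 2 + n - 1 - dirSize G u v * dirSize G v u -
        (sumSq G u + sumSq G v)) := by
  have hn : (dirSize G u v : ℤ) + dirSize G v u = n := by
    exact_mod_cast Fintype.card_fin n ▸ dirSize_add_dirSize hG h
  have hu := three_mul_sum_numSeparating_side hG h
  have hv := three_mul_sum_numSeparating_side hG h.symm
  have hcross := two_mul_sum_numSeparating_side_side hG h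
  rw [sum_edgeLength_eq_sum_numSeparating G h.ne, sum_numSeparating_eq_sum_side hG h, ← hn]
  linear_combination hu + hv + 3 * hcross

theorem two_mul_sum_sumEdgeLengths (G : SimpleGraph (Fin n)) [DecidableRel G.Adj] :
    2 * ∑ π ∈ planarArrangements G, sumEdgeLengths G π =
      ∑ u, ∑ w ∈ G.neighborFinset u, ∑ π ∈ planarArrangements G, edgeLength π s(u, w) := by
  rw [sum_neighborFinset_edge fun e => ∑ π ∈ planarArrangements G, edgeLength π e,
    Finset.sum_comm, nsmul_eq_mul]
  simp only [sumEdgeLengths]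
  congr!

theorem six_mul_sum_sumEdgeLengths (hG : G.IsTree) :
    6 * n * ∑ π ∈ planarArrangements G, sumEdgeLengths G π =
      (planarArrangements G).card *
        ((n - 1) * (3 * n ^ 2 + 2 * n - 2) - ∑ u, (2 * (G.degree u : ℤ) - 1) * sumSq G u) := by
  have hedges : 3 * n * ∑ u, ∑ w ∈ G.neighborFinset u,
      ∑ π ∈ planarArrangements G, edgeLength π s(u, w) =
      (planarArrangements G).card * ∑ u, ∑ w ∈ G.neighborFinset u,
        (2 * n ^ 2 + n - 1 - dirSize G u w * dirSize G w u - (sumSq G u + sumSq G w)) := by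
    simp only [Finset.mul_sum (s := Finset.univ), Finset.mul_sum (s := G.neighborFinset _)]
    refine Finset.sum_congr rfl fun u _ => Finset.sum_congr rfl fun w hw => ?_
    rw [← three_mul_sum_edgeLength hG ((G.mem_neighborFinset _ _).1 hw), mul_assoc]
  have hconst : ∀ c : ℤ, ∑ u, ∑ _w ∈ G.neighborFinset u, c = 2 * (n - 1) * c := by
    intro c
    simp only [Finset.sum_const, SimpleGraph.card_neighborFinset_eq_degree, nsmul_eq_mul,
      ← Finset.sum_mul, sum_degree hG, Fintype.card_fin]
  have hdegree : ∑ u, (2 * (G.degree u : ℤ) - 1) * sumSq G u =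
      2 * ∑ u, (G.degree u : ℤ) * sumSq G u - ∑ u, sumSq G u := by
    rw [Finset.mul_sum, ← Finset.sum_sub_distrib]
    exact Finset.sum_congr rfl fun u _ => by ring
  generalize hc : (2 * n ^ 2 + n - 1 : ℤ) = c at hedges
  simp only [Finset.sum_sub_distrib] at hedges
  rw [hconst, sum_sumSq_add_sumSq, sum_dirSize_mul_dirSize hG, ← two_mul_sum_sumEdgeLengths,
    Fintype.card_fin] at hedges
  rw [hdegree]
  subst hc
  linear_combination hedges

end EdgeSum

section Existence

variable {V : Type*} {G : SimpleGraph V}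

/-- No two edges cross when each vertex `x` is placed at `f x`. -/
def IsNoncrossing (G : SimpleGraph V) (f : V → ℕ) : Prop :=
  ∀ s t u v, G.Adj s t → G.Adj u v → ¬ (f s < f u ∧ f u < f t ∧ f t < f v)

theorem exists_isNoncrossing_of_leaf {x y : V} (hxy : G.Adj x y)
    (hleaf : ∀ w, G.Adj x w → w = y)
    (h : ∃ g : ({x}ᶜ : Set V) → ℕ, g.Injective ∧ IsNoncrossing (G.induce {x}ᶜ) g) :
    ∃ f : V → ℕ, f.Injective ∧ IsNoncrossing G f := by
  classical
  obtain ⟨g, hinj, hcross⟩ := h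
  -- the leaf goes right after its neighbour
  let f : V → ℕ := fun z => if hz : z = x then 2 * g ⟨y, hxy.ne'⟩ + 1 else 2 * g ⟨z, hz⟩
  have hfx : f x = 2 * g ⟨y, hxy.ne'⟩ + 1 := dif_pos rfl
  have hf : ∀ {z} (hz : z ≠ x), f z = 2 * g ⟨z, hz⟩ := fun hz => dif_neg hz
  have hfy := hf hxy.ne'
  refine ⟨f, fun a b hab => ?_, fun s t u v hst huv hlt => ?_⟩
  · by_cases ha : a = x <;> by_cases hb : b = x
    · rw [ha, hb]
    · rw [ha, hfx, hf hb] at hab; omega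
    · rw [hb, hfx, hf ha] at hab; omega
    · rw [hf ha, hf hb] at hab
      exact congrArg Subtype.val (hinj (by omega : g ⟨a, ha⟩ = g ⟨b, hb⟩))
  · have hs : s ≠ x := by rintro rfl; rw [hleaf t hst] at hlt; omega
    have ht : t ≠ x := by rintro rfl; rw [hleaf s hst.symm] at hlt; omega
    have hu : u ≠ x := by rintro rfl; rw [hleaf v huv] at hlt; omega
    have hv : v ≠ x := by rintro rfl; rw [hleaf u huv.symm] at hlt; omega
    rw [hf hs, hf ht, hf hu, hf hv] at hlt
    exact hcross ⟨s, hs⟩ ⟨t, ht⟩ ⟨u, hu⟩ ⟨v, hv⟩ hst huv (by omega)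

theorem exists_isNoncrossing [Finite V] (hG : G.IsTree) :
    ∃ f : V → ℕ, f.Injective ∧ IsNoncrossing G f := by
  classical
  induction hn : Nat.card V using Nat.strong_induction_on generalizing V with
  | h n ih =>
    rcases subsingleton_or_nontrivial V with _ | _
    · exact ⟨fun _ => 0, Function.injective_of_subsingleton _, fun _ _ _ _ _ _ h => h.1.false⟩
    have := Fintype.ofFinite V
    obtain ⟨x, hx⟩ := hG.exists_vert_degree_one_of_nontrivial
    obtain ⟨y, hxy, hleaf⟩ := SimpleGraph.degree_eq_one_iff_existsUnique_adj.1 hx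
    refine exists_isNoncrossing_of_leaf hxy hleaf (ih _ ?_ ⟨?_, hG.isAcyclic.induce _⟩ rfl)
    · rw [← hn, Nat.card_coe_set_eq]
      exact Set.ncard_lt_card (by simp)
    · exact hG.connected.induce_compl_singleton_of_degree_eq_one hx

end Existence

section Expectation

variable {n : ℕ} {G : SimpleGraph (Fin n)}

theorem planarArrangements_nonempty (hG : G.IsTree) : (planarArrangements G).Nonempty := by
  obtain ⟨f, hinj, hcross⟩ := exists_isNoncrossing hG
  obtain ⟨π, hπ⟩ := exists_perm_lt_iff hinj
  refine ⟨π, mem_planarArrangements.2 fun s t u v hst huv => ?_⟩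
  rw [hπ, hπ, hπ]
  exact hcross s t u v hst huv

theorem expectedPlanar_eq [DecidableRel G.Adj] (hG : G.IsTree) :
    expectedPlanar G =
      (((n - 1) * (3 * n ^ 2 + 2 * n - 2) -
        ∑ u, (2 * (G.degree u : ℤ) - 1) * sumSq G u : ℤ) : ℚ) / ((6 * n : ℤ) : ℚ) := by
  have hn : n ≠ 0 := hG.connected.nonempty.some.pos.ne'
  have hcard : ((planarArrangements G).card : ℚ) ≠ 0 :=
    Nat.cast_ne_zero.2 (Finset.card_pos.2 (planarArrangements_nonempty hG)).ne'
  have hden : ((6 * n : ℤ) : ℚ) ≠ 0 := by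
    push_cast
    positivity
  rw [expectedPlanar, div_eq_div_iff hcard hden, ← Int.cast_sum, mul_comm, ← Int.cast_mul,
    six_mul_sum_sumEdgeLengths hG, Int.cast_mul, Int.cast_natCast, mul_comm]

end Expectation

/-! ### Computations of the machine -/

section Machine

/-- All words in memory are at most `M` in absolute value. -/
def Config.BoundedBy (M : ℤ) (c : Config) : Prop := ∀ w ∈ c.words, |w| ≤ M

theorem Config.boundedBy_iff {M : ℤ} {c : Config} : c.BoundedBy M ↔
    (∀ w ∈ c.loc, |w| ≤ M) ∧ (∀ act ∈ c.stack, ∀ w ∈ act.loc, |w| ≤ M) ∧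
      ∀ l ∈ c.heap, ∀ w ∈ l, |w| ≤ M := by
  simp only [Config.BoundedBy, Config.words, List.mem_append, List.mem_flatMap, List.mem_flatten,
    or_imp, forall_and, forall_exists_index, and_imp, and_assoc]
  tauto

theorem Program.init_boundedBy (P : Program) {M : ℤ} (hM : 0 ≤ M) : P.init.BoundedBy M := by
  refine Config.boundedBy_iff.2 ⟨fun w hw => ?_, by simp [Program.init], fun l hl w hw => ?_⟩
  · rwa [List.eq_of_mem_replicate hw, abs_zero]
  · simp [List.eq_of_mem_replicate hl] at hw

/-- A step that preserves the bound `M` on the words in memory, and in which the space grows by at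
most `20` times the time; `20` exceeds the length of every block of statements of the algorithm. -/
structure GoodStep (P : Program) {n : ℕ} (A : AdjLists n) (M : ℤ) (c c' : Config) : Prop where
  step_eq : step P A c = some c'
  boundedBy : c.BoundedBy M → c'.BoundedBy M
  clock_le : c.clock ≤ c'.clock
  space_le : c'.space A + 20 * c.clock ≤ c.space A + 20 * c'.clock

/-- The part of a configuration on which a block of statements operates: the local variables of the
current procedure and the working arrays. -/
structure Memory : Type where
  loc : List ℤ
  heap : List (List ℤ)

/-- The configuration with the given memory. -/
def Memory.config (μ : Memory) (code : List Stmt) (stack : List Act) (clock : ℕ) : Config :=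
  ⟨code, μ.loc, stack, μ.heap, clock⟩

/-- Whatever is left to do afterwards, the block `code` turns the memory `μ` into `μ'` by good steps
in at most `b` units of time. -/
def Runs (P : Program) {n : ℕ} (A : AdjLists n) (M : ℤ) (b : ℕ) (code : List Stmt)
    (μ μ' : Memory) : Prop :=
  ∀ rest stack t, ∃ t' ≤ t + b, Relation.ReflTransGen (GoodStep P A M)
    (μ.config (code ++ rest) stack t) (μ'.config rest stack t')

variable {P : Program} {n : ℕ} {A : AdjLists n} {M : ℤ}

theorem exists_run_of_reflTransGen {c : Config} (hM : 0 ≤ M)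
    (h : Relation.ReflTransGen (GoodStep P A M) P.init c) :
    ∃ k, P.run A k = some c ∧ ∀ j ≤ k, ∃ d, P.run A j = some d ∧ d.BoundedBy M ∧
      d.clock ≤ c.clock ∧ d.space A + 20 * P.init.clock ≤ P.init.space A + 20 * d.clock := by
  induction h with
  | refl =>
    refine ⟨0, rfl, fun j hj => ?_⟩
    obtain rfl := Nat.le_zero.1 hj
    exact ⟨P.init, rfl, P.init_boundedBy hM, le_rfl, le_rfl⟩
  | @tail c c' _ hstep ih =>
    obtain ⟨k, hk, hbefore⟩ := ih
    have hrun : P.run A (k + 1) = some c' := by rw [Program.run, hk]; exact hstep.step_eq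
    refine ⟨k + 1, hrun, fun j hj => ?_⟩
    rcases Nat.le_succ_iff.1 hj with hj | rfl
    · obtain ⟨d, hd, hbound, hclock, hspace⟩ := hbefore j hj
      exact ⟨d, hd, hbound, hclock.trans hstep.clock_le, hspace⟩
    · obtain ⟨d, hd, hbound, -, hspace⟩ := hbefore k le_rfl
      obtain rfl : d = c := Option.some_injective _ (hd.symm.trans hk)
      have := hstep.space_le
      exact ⟨c', hrun, hstep.boundedBy hbound, le_rfl, by omega⟩

theorem Runs.exists_run {b : ℕ} {μ : Memory} (hM : 0 ≤ M)
    (h : Runs P A M b P.main.body ⟨P.init.loc, P.init.heap⟩ μ) :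
    ∃ k c, P.run A k = some c ∧ c.code = [] ∧ c.stack = [] ∧ c.loc = μ.loc ∧ c.clock ≤ b ∧
      ∀ j ≤ k, ∃ d, P.run A j = some d ∧ d.BoundedBy M ∧
        d.space A ≤ P.init.space A + 20 * b := by
  obtain ⟨t, ht, hreach⟩ := h [] [] 0
  rw [List.append_nil] at hreach
  obtain ⟨k, hk, hbefore⟩ := exists_run_of_reflTransGen hM hreach
  refine ⟨k, _, hk, rfl, rfl, rfl, ht.trans (zero_add b).le, fun j hj => ?_⟩
  obtain ⟨d, hd, hbound, hclock, hspace⟩ := hbefore j hj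
  simp only [Memory.config, Program.init] at hclock hspace ⊢
  exact ⟨d, hd, hbound, by omega⟩

theorem Runs.nil (μ : Memory) : Runs P A M 0 [] μ μ := fun _ _ t => ⟨t, le_rfl, .refl⟩

theorem Runs.append {b b' : ℕ} {code code' : List Stmt} {μ μ' μ'' : Memory}
    (h : Runs P A M b code μ μ') (h' : Runs P A M b' code' μ' μ'') :
    Runs P A M (b + b') (code ++ code') μ μ'' := by
  intro rest stack t
  obtain ⟨t', ht', hreach⟩ := h (code' ++ rest) stack t
  obtain ⟨t'', ht'', hreach'⟩ := h' rest stack t'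
  rw [← List.append_assoc] at hreach
  exact ⟨t'', by omega, hreach.trans hreach'⟩

theorem Runs.cons {b b' : ℕ} {s : Stmt} {code : List Stmt} {μ μ' μ'' : Memory}
    (h : Runs P A M b [s] μ μ') (h' : Runs P A M b' code μ' μ'') :
    Runs P A M (b + b') (s :: code) μ μ'' := h.append h'

theorem Runs.mono {b b' : ℕ} {code : List Stmt} {μ μ' : Memory} (h : Runs P A M b code μ μ')
    (hb : b ≤ b') : Runs P A M b' code μ μ' := by
  intro rest stack t
  obtain ⟨t', ht', hreach⟩ := h rest stack t
  exact ⟨t', by omega, hreach⟩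

theorem Runs.of_goodStep {b : ℕ} {s : Stmt} {μ μ' : Memory}
    (h : ∀ rest stack t,
      GoodStep P A M (μ.config (s :: rest) stack t) (μ'.config rest stack (t + b))) :
    Runs P A M b [s] μ μ' := fun rest stack t => ⟨t + b, le_rfl, .single (h rest stack t)⟩

theorem Runs.assign {x : ℕ} {e : Exp} {μ : Memory} (z : ℤ)
    (hz : e.eval A μ.loc μ.heap = some z) (hx : x < μ.loc.length) (hM : |z| ≤ M) :
    Runs P A M (1 + e.cost) [.assign x e] μ ⟨μ.loc.set x z, μ.heap⟩ := by
  refine .of_goodStep fun rest stack t => ⟨?_, ?_, ?_, ?_⟩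
  · simp [step, Memory.config, hz, hx, Nat.add_assoc]
  · simp only [Config.boundedBy_iff, Memory.config]
    rintro ⟨hloc, hrest⟩
    refine ⟨fun w hw => ?_, hrest⟩
    rcases List.mem_or_eq_of_mem_set hw with hw | rfl
    exacts [hloc w hw, hM]
  · simp [Memory.config]
  · simp only [Memory.config, Config.space, Config.words, List.length_append, List.length_set,
      List.length_cons]
    omega

theorem length_flatten_set {heap : List (List ℤ)} {a : ℕ} {l l' : List ℤ}
    (h : heap[a]? = some l) :
    (heap.set a l').flatten.length + l.length = heap.flatten.length + l'.length := by
  induction heap generalizing a with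
  | nil => simp at h
  | cons l₀ heap ih =>
    cases a with
    | zero => simp_all [Nat.add_comm, Nat.add_left_comm]
    | succ a =>
      have := ih h
      simp only [List.set_cons_succ, List.flatten_cons, List.length_append]
      omega

theorem length_of_writeAt {l l' : List ℤ} {j z : ℤ} (h : writeAt l j z = some l') :
    l'.length = l.length := by
  obtain ⟨-, ⟨⟩⟩ := Option.ite_none_right_eq_some.1 h
  exact List.length_set

theorem mem_of_writeAt {l l' : List ℤ} {j z w : ℤ} (h : writeAt l j z = some l') (hw : w ∈ l') :
    w ∈ l ∨ w = z := by
  obtain ⟨-, ⟨⟩⟩ := Option.ite_none_right_eq_some.1 h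
  exact List.mem_or_eq_of_mem_set hw

theorem Runs.store {a : ℕ} {i e : Exp} {μ : Memory} {l l' : List ℤ} (j z : ℤ)
    (hj : i.eval A μ.loc μ.heap = some j) (hz : e.eval A μ.loc μ.heap = some z)
    (hl : μ.heap[a]? = some l) (hl' : writeAt l j z = some l') (hM : |z| ≤ M) :
    Runs P A M (1 + i.cost + e.cost) [.store a i e] μ ⟨μ.loc, μ.heap.set a l'⟩ := by
  refine .of_goodStep fun rest stack t => ⟨?_, ?_, ?_, ?_⟩
  · simp [step, Memory.config, hj, hz, hl, hl', Nat.add_assoc]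
  · simp only [Config.boundedBy_iff, Memory.config]
    rintro ⟨hloc, hstack, hheap⟩
    refine ⟨hloc, hstack, fun m hm w hw => ?_⟩
    rcases List.mem_or_eq_of_mem_set hm with hm | rfl
    · exact hheap m hm w hw
    · rcases mem_of_writeAt hl' hw with hw | rfl
      exacts [hheap l (List.mem_of_getElem? hl) w hw, hM]
  · simp [Memory.config]
  · have hwords := length_flatten_set (l' := l') hl
    have hlength := length_of_writeAt hl'
    simp only [Memory.config, Config.space, Config.words, List.length_append, List.length_cons]
    omega

theorem Runs.alloc {a : ℕ} {e : Exp} {μ : Memory} (k : ℕ)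
    (hk : e.eval A μ.loc μ.heap = some (k : ℤ)) (ha : a < μ.heap.length) (hM : 0 ≤ M) :
    Runs P A M (1 + e.cost + k) [.alloc a e] μ ⟨μ.loc, μ.heap.set a (List.replicate k 0)⟩ := by
  refine .of_goodStep fun rest stack t => ⟨?_, ?_, ?_, ?_⟩
  · simp [step, Memory.config, hk, ha, Nat.add_assoc]
  · simp only [Config.boundedBy_iff, Memory.config]
    rintro ⟨hloc, hstack, hheap⟩
    refine ⟨hloc, hstack, fun m hm w hw => ?_⟩
    rcases List.mem_or_eq_of_mem_set hm with hm | rfl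
    · exact hheap m hm w hw
    · rwa [List.eq_of_mem_replicate hw, abs_zero]
  · simp [Memory.config]
  · have hwords := length_flatten_set (l' := List.replicate k 0) (List.getElem?_eq_getElem ha)
    rw [List.length_replicate] at hwords
    simp only [Memory.config, Config.space, Config.words, List.length_append, List.length_cons]
    omega

theorem Runs.jump {b k : ℕ} {s : Stmt} {code : List Stmt} {μ μ' : Memory}
    (hstep : ∀ rest stack t, step P A (μ.config (s :: rest) stack t) =
      some (μ.config (code ++ rest) stack (t + k)))
    (hk : 0 < k) (hcode : code.length ≤ 20) (h : Runs P A M b code μ μ') :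
    Runs P A M (k + b) [s] μ μ' := by
  intro rest stack t
  obtain ⟨t', ht', hreach⟩ := h rest stack (t + k)
  refine ⟨t', by omega, .head ⟨hstep rest stack t, ?_, ?_, ?_⟩ hreach⟩
  · simp [Config.boundedBy_iff, Memory.config]
  · simp [Memory.config]
  · simp only [Memory.config, Config.space, Config.words, List.length_append, List.length_cons]
    omega

theorem Runs.cond_true {b : ℕ} {c : Test} {body : List Stmt} {μ μ' : Memory}
    (hc : c.eval A μ.loc μ.heap = some true) (hbody : body.length ≤ 20)
    (h : Runs P A M b body μ μ') : Runs P A M (1 + c.cost + b) [.cond c body] μ μ' :=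
  h.jump (fun _ _ _ => by simp [step, Memory.config, hc, Nat.add_assoc]) (by omega) hbody

theorem Runs.cond_false {c : Test} {body : List Stmt} {μ : Memory}
    (hc : c.eval A μ.loc μ.heap = some false) :
    Runs P A M (1 + c.cost) [.cond c body] μ μ :=
  (Runs.nil μ).jump (k := 1 + c.cost)
    (fun _ _ _ => by simp [step, Memory.config, hc, Nat.add_assoc]) (by omega) (by simp)

theorem Runs.loop_true {b b' : ℕ} {c : Test} {body : List Stmt} {μ μ' μ'' : Memory}
    (hc : c.eval A μ.loc μ.heap = some true) (hbody : body.length < 20)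
    (h : Runs P A M b body μ μ') (h' : Runs P A M b' [.loop c body] μ' μ'') :
    Runs P A M (1 + c.cost + (b + b')) [.loop c body] μ μ'' :=
  (h.append h').jump (fun _ _ _ => by simp [step, Memory.config, hc, Nat.add_assoc]) (by omega)
    (by simpa using hbody)

theorem Runs.loop_false {c : Test} {body : List Stmt} {μ : Memory}
    (hc : c.eval A μ.loc μ.heap = some false) :
    Runs P A M (1 + c.cost) [.loop c body] μ μ :=
  (Runs.nil μ).jump (k := 1 + c.cost)
    (fun _ _ _ => by simp [step, Memory.config, hc, Nat.add_assoc]) (by omega) (by simp)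

theorem Runs.exists_loop {c : Test} {body : List Stmt} {m : ℕ} {μ : Memory} (I : ℕ → Memory → Prop)
    (T : ℕ → ℕ) (hbody : body.length < 20) (hinit : I 0 μ)
    (hstep : ∀ i < m, ∀ ν, I i ν → c.eval A ν.loc ν.heap = some true ∧
      ∃ b ν', T i + (1 + c.cost + b) ≤ T (i + 1) ∧ I (i + 1) ν' ∧ Runs P A M b body ν ν')
    (hexit : ∀ ν, I m ν → c.eval A ν.loc ν.heap = some false) :
    ∃ μ', I m μ' ∧ Runs P A M (T m + (1 + c.cost)) [.loop c body] μ μ' := by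
  suffices h : ∀ j i, i + j = m → ∀ ν, I i ν →
      ∃ b ν', T i + b ≤ T m + (1 + c.cost) ∧ I m ν' ∧ Runs P A M b [.loop c body] ν ν' by
    obtain ⟨b, μ', hb, hμ', hruns⟩ := h m 0 (zero_add m) μ hinit
    exact ⟨μ', hμ', hruns.mono (by omega)⟩
  intro j
  induction j with
  | zero =>
    rintro i rfl ν hν
    exact ⟨_, ν, le_rfl, hν, .loop_false (hexit ν hν)⟩
  | succ j ih =>
    intro i hi ν hν
    obtain ⟨htest, b, ν', hb, hν', hruns⟩ := hstep i (by omega) ν hν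
    obtain ⟨b', μ', hb', hμ', hruns'⟩ := ih (i + 1) (by omega) ν' hν'
    exact ⟨_, μ', by omega, hμ', .loop_true htest hbody hruns hruns'⟩

theorem goodStep_call {x p : ℕ} {args : List Exp} {μ : Memory} {q : Proc} {zs : List ℤ}
    (hq : P.procs[p]? = some q) (hargs : evalArgs A μ.loc μ.heap args = some zs)
    (hlocals : zs.length ≤ q.locals) (hbody : q.body.length ≤ 20) (hM : 0 ≤ M)
    (hzs : ∀ z ∈ zs, |z| ≤ M) (rest : List Stmt) (stack : List Act) (t : ℕ) :
    GoodStep P A M (μ.config (.call x p args :: rest) stack t)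
      (Memory.config ⟨zs ++ List.replicate (q.locals - zs.length) 0, μ.heap⟩ q.body
        (⟨rest, μ.loc, x⟩ :: stack) (t + (1 + (args.map Exp.cost).sum + q.locals))) := by
  refine ⟨?_, ?_, ?_, ?_⟩
  · simp [step, Memory.config, hq, hargs, hlocals, Nat.add_assoc]
  · simp only [Config.boundedBy_iff, Memory.config, List.forall_mem_append, List.forall_mem_cons]
    rintro ⟨hloc, hstack, hheap⟩
    refine ⟨⟨hzs, fun w hw => ?_⟩, ⟨hloc, hstack⟩, hheap⟩
    rwa [List.eq_of_mem_replicate hw, abs_zero]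
  · simp [Memory.config]
  · simp only [Memory.config, Config.space, Config.words, List.length_append, List.length_cons,
      List.flatMap_cons, List.map_cons, List.sum_cons, List.length_replicate]
    omega

theorem goodStep_ret {e : Exp} {μ : Memory} {act : Act} {z : ℤ}
    (hz : e.eval A μ.loc μ.heap = some z) (hdest : act.dest < act.loc.length) (hM : |z| ≤ M)
    (rest : List Stmt) (stack : List Act) (t : ℕ) :
    GoodStep P A M (μ.config (.ret e :: rest) (act :: stack) t)
      (Memory.config ⟨act.loc.set act.dest z, μ.heap⟩ act.code stack (t + (1 + e.cost))) := by
  refine ⟨?_, ?_, ?_, ?_⟩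
  · simp [step, Memory.config, hz, hdest, Nat.add_assoc]
  · simp only [Config.boundedBy_iff, Memory.config, List.forall_mem_cons]
    rintro ⟨-, ⟨hact, hstack⟩, hheap⟩
    refine ⟨fun w hw => ?_, hstack, hheap⟩
    rcases List.mem_or_eq_of_mem_set hw with hw | rfl
    exacts [hact w hw, hM]
  · simp [Memory.config]
  · simp only [Memory.config, Config.space, Config.words, List.length_append, List.length_cons,
      List.flatMap_cons, List.map_cons, List.sum_cons, List.length_set]
    omega

theorem Runs.call {b x p : ℕ} {args : List Exp} {μ μ' : Memory} {q : Proc} {zs : List ℤ}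
    {code : List Stmt} {e : Exp} {z : ℤ} (hq : P.procs[p]? = some q)
    (hcode : q.body = code ++ [.ret e]) (hbody : q.body.length ≤ 20)
    (hargs : evalArgs A μ.loc μ.heap args = some zs) (hlocals : zs.length ≤ q.locals)
    (hM : 0 ≤ M) (hzs : ∀ w ∈ zs, |w| ≤ M) (hx : x < μ.loc.length)
    (h : Runs P A M b code ⟨zs ++ List.replicate (q.locals - zs.length) 0, μ.heap⟩ μ')
    (hret : e.eval A μ'.loc μ'.heap = some z) (hz : |z| ≤ M) :
    Runs P A M (1 + (args.map Exp.cost).sum + q.locals + b + (1 + e.cost)) [.call x p args] μ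
      ⟨μ.loc.set x z, μ'.heap⟩ := by
  intro rest stack t
  have hcall := goodStep_call (x := x) hq hargs hlocals hbody hM hzs rest stack t
  obtain ⟨t', ht', hreach⟩ := h [.ret e] (⟨rest, μ.loc, x⟩ :: stack)
    (t + (1 + (args.map Exp.cost).sum + q.locals))
  rw [hcode] at hcall
  have hreturn := goodStep_ret (P := P) (act := ⟨rest, μ.loc, x⟩) hret hx hz [] stack t'
  exact ⟨_, by omega, .head hcall (hreach.tail hreturn)⟩

end Machine

/-! ### Arrays -/

section Arrays

/-- The array of length `N` that starts with the entries of `l` and is filled up with zeros. -/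
def pad (N : ℕ) (l : List ℤ) : List ℤ := l ++ List.replicate (N - l.length) 0

theorem writeAt_pad {N : ℕ} {l : List ℤ} (h : l.length < N) (z : ℤ) :
    writeAt (pad N l) l.length z = some (pad N (l ++ [z])) := by
  have hlength : (pad N l).length = N := by simp [pad, h.le]
  rw [writeAt, if_pos (by simp [hlength, h]), Int.toNat_natCast, pad,
    List.set_append_right _ _ le_rfl, Nat.sub_self,
    show N - l.length = N - (l.length + 1) + 1 by omega, List.replicate_succ]
  simp [pad]

theorem readAt_pad {N : ℕ} {l : List ℤ} {i : ℕ} (h : i < l.length) :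
    readAt (pad N l) i = some l[i] := by
  simp [readAt, pad, List.getElem?_append_left h]

variable {n : ℕ}

theorem readAt_ofFn (f : Fin n → ℤ) (v : Fin n) :
    readAt (List.ofFn f) ((v : ℕ) : ℤ) = some (f v) := by
  simp [readAt]

theorem writeAt_ofFn (f : Fin n → ℤ) (v : Fin n) (z : ℤ) :
    writeAt (List.ofFn f) ((v : ℕ) : ℤ) z = some (List.ofFn (Function.update f v z)) := by
  rw [writeAt, if_pos (by simp)]
  refine congrArg some (List.ext_getElem (by simp) fun i _ _ => ?_)
  simp only [Int.toNat_natCast, List.getElem_set, List.getElem_ofFn, Function.update_apply,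
    Fin.ext_iff, eq_comm]

theorem degAt_coe (A : AdjLists n) (v : Fin n) :
    degAt A ((v : ℕ) : ℤ) = some ((A v).length : ℤ) := by
  simp [degAt]

theorem nbrAt_coe (A : AdjLists n) (v : Fin n) {i : ℕ} (hi : i < (A v).length) :
    nbrAt A ((v : ℕ) : ℤ) i = some (((A v)[i] : ℕ) : ℤ) := by
  rw [nbrAt, dif_pos ⟨Int.natCast_nonneg _, by simp⟩]
  simp only [readAt, if_pos (Int.natCast_nonneg _), Int.toNat_natCast, Fin.eta, bind_pure_comp,
    List.map_eq_map, List.map_map]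
  simp [hi]

theorem sum_map_take_succ {α M : Type*} [AddCommMonoid M] (f : α → M) {l : List α} {i : ℕ}
    (h : i < l.length) :
    ((l.take (i + 1)).map f).sum = ((l.take i).map f).sum + f l[i] := by
  rw [List.take_add_one, List.getElem?_eq_getElem h, Option.toList_some, List.map_append,
    List.sum_append, List.map_singleton, List.sum_singleton]

theorem sum_map_take_le {α : Type*} (f : α → ℕ) (l : List α) (i : ℕ) :
    ((l.take i).map f).sum ≤ (l.map f).sum :=
  ((List.take_sublist i l).map f).sum_le_sum fun _ _ => Nat.zero_le _

variable {G : SimpleGraph (Fin n)} {A : AdjLists n}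

theorem AdjLists.Represents.length_le (hA : A.Represents G) (v : Fin n) : (A v).length ≤ n := by
  simpa using (hA v).1.length_le_card

variable [DecidableRel G.Adj]

theorem AdjLists.Represents.toFinset_eq (hA : A.Represents G) (v : Fin n) :
    (A v).toFinset = G.neighborFinset v := by
  ext w
  rw [List.mem_toFinset, (hA v).2, SimpleGraph.mem_neighborFinset]

theorem AdjLists.Represents.length_eq_degree (hA : A.Represents G) (v : Fin n) :
    (A v).length = G.degree v := by
  rw [← List.toFinset_card_of_nodup (hA v).1, hA.toFinset_eq,
    SimpleGraph.card_neighborFinset_eq_degree]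

variable {M : Type*} [AddCommMonoid M]

theorem AdjLists.Represents.sum_map (hA : A.Represents G) (v : Fin n) (f : Fin n → M) :
    ((A v).map f).sum = ∑ w ∈ G.neighborFinset v, f w := by
  rw [← List.sum_toFinset f (hA v).1, hA.toFinset_eq]

theorem AdjLists.Represents.sum_map_ite (hA : A.Represents G) {u v : Fin n} (h : G.Adj v u) (c : M)
    (f : Fin n → M) : ((A v).map fun w => if w = u then c else f w).sum =
      c + ∑ w ∈ (G.neighborFinset v).erase u, f w := by
  rw [hA.sum_map, ← Finset.add_sum_erase _ _ ((G.mem_neighborFinset v u).2 h), if_pos rfl]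
  exact congrArg _ (Finset.sum_congr rfl fun w hw => if_neg (Finset.ne_of_mem_erase hw))

end Arrays

/-! ### The pairs that the procedure `sizes` records -/

section BranchPairs

variable {V : Type*} [Fintype V] [DecidableEq V]

/-- The two orientations of every edge from a vertex of the branch of `v` at `u` towards `u`. -/
noncomputable def branchPairs (G : SimpleGraph V) (u v : V) : Multiset (V × V) :=
  ∑ x ∈ branch G u v, {(x, toward G x u), (toward G x u, x)}

theorem card_branchPairs (G : SimpleGraph V) (u v : V) :
    (branchPairs G u v).card = 2 * dirSize G u v := by
  simp [branchPairs, dirSize, Multiset.card_sum, mul_comm]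

variable {G : SimpleGraph V} [DecidableRel G.Adj]

theorem branchPairs_eq (hG : G.IsTree) {u v : V} (h : G.Adj u v) :
    branchPairs G u v =
      {(u, v), (v, u)} + ∑ w ∈ (G.neighborFinset v).erase u, branchPairs G v w := by
  rw [branchPairs, sum_branch hG _ h, toward_of_adj hG.isAcyclic h.symm, Multiset.pair_comm]
  refine congrArg _ (Finset.sum_congr rfl fun w hw => Finset.sum_congr rfl fun x hx => ?_)
  rw [Finset.mem_erase, SimpleGraph.mem_neighborFinset] at hw
  rw [mem_branch] at hx
  have hux : u ≠ x := fun e => hw.1 (by rw [← hx, ← e, toward_of_adj hG.isAcyclic h.symm])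
  have hvx : v ≠ x := fun e => hw.2.ne (by rw [← hx, ← e, toward_self])
  rw [toward_congr hG h hux hvx]

theorem sum_branchPairs (hG : G.IsTree) (r : V) :
    ∑ w ∈ G.neighborFinset r, branchPairs G r w = ∑ u, ∑ w ∈ G.neighborFinset u, {(u, w)} := by
  rw [sum_neighborFinset_eq_sum_parent hG r]
  exact sum_branches hG.connected _ r

end BranchPairs

/-! ### The procedure `sizes` -/

section Sizes

variable {n : ℕ} {G : SimpleGraph (Fin n)} {A : AdjLists n} {M : ℤ}

theorem abs_natCast_le {m : ℕ} (hM : 2 * (n : ℤ) ≤ M) (h : m ≤ 2 * n) : |(m : ℤ)| ≤ M := by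
  rw [abs_of_nonneg (Int.natCast_nonneg m)]
  exact le_trans (by exact_mod_cast h) hM

/-- The working arrays when the counter is `m` and the triples `(a, b, s_a(b))`, for the pairs
`(a, b)` in `l`, have been recorded. -/
noncomputable def tripleArrays (G : SimpleGraph (Fin n)) (m : ℤ) (l : List (Fin n × Fin n)) :
    List (List ℤ) :=
  [[m], pad (2 * (n - 1)) (l.map fun p => ((p.1 : ℕ) : ℤ)),
    pad (2 * (n - 1)) (l.map fun p => ((p.2 : ℕ) : ℤ)),
    pad (2 * (n - 1)) (l.map fun p => (dirSize G p.1 p.2 : ℤ)), []]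

/-- The working arrays that represent the triples `(a, b, s_a(b))` for the pairs `(a, b)` in `l`. -/
noncomputable def tripleHeap (G : SimpleGraph (Fin n)) (l : List (Fin n × Fin n)) :
    List (List ℤ) := tripleArrays G l.length l

/-- Record the triple `(a, b, s)` at the position in the variable `6`, and advance that position. -/
def recordTriple (a b s : Exp) : List Stmt :=
  [.store src (.var 6) a, .store dst (.var 6) b, .store siz (.var 6) s,
    .assign 6 (.add (.var 6) (.lit 1))]

theorem runs_recordTriple {P : Program} (hM : 2 * (n : ℤ) ≤ M) {m : ℤ}
    {l : List (Fin n × Fin n)} (hl : l.length < 2 * (n - 1)) {loc : List ℤ}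
    (hloc : loc[6]? = some (l.length : ℤ)) {a b : Fin n} {ea eb es : Exp}
    (hea : ∀ heap, ea.eval A loc heap = some ((a : ℕ) : ℤ))
    (heb : ∀ heap, eb.eval A loc heap = some ((b : ℕ) : ℤ))
    (hes : ∀ heap, es.eval A loc heap = some (dirSize G a b : ℤ)) :
    Runs P A M (10 + ea.cost + eb.cost + es.cost) (recordTriple ea eb es)
      ⟨loc, tripleArrays G m l⟩
      ⟨loc.set 6 ((l.length + 1 : ℕ) : ℤ), tripleArrays G m (l ++ [(a, b)])⟩ := by
  have hpad : ∀ f : Fin n × Fin n → ℤ, writeAt (pad (2 * (n - 1)) (l.map f)) l.length (f (a, b)) =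
      some (pad (2 * (n - 1)) ((l ++ [(a, b)]).map f)) := fun f => by
    simpa using writeAt_pad (l := l.map f) (by simpa using hl) (f (a, b))
  have ha : |((a : ℕ) : ℤ)| ≤ M := abs_natCast_le hM (by omega)
  have hb : |((b : ℕ) : ℤ)| ≤ M := abs_natCast_le hM (by omega)
  have hs : |(dirSize G a b : ℤ)| ≤ M :=
    abs_natCast_le hM (by have := dirSize_le G a b; rw [Fintype.card_fin] at this; omega)
  have hk : |((l.length + 1 : ℕ) : ℤ)| ≤ M := abs_natCast_le hM (by omega)
  refine Runs.mono (.cons (.store _ _ hloc (hea _) rfl (hpad _) ha) <|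
    .cons (.store _ _ hloc (heb _) rfl (hpad _) hb) <|
    .cons (.store _ _ hloc (hes _) rfl (hpad _) hs) <|
    .assign _ ?_ (List.getElem?_eq_some_iff.1 hloc).1 hk) ?_
  · simp [Exp.eval, hloc]
  · simp only [Exp.cost]
    omega

/-- The part of the procedure `sizes` after its loop, without the return. -/
def sizesRecord : List Stmt :=
  .assign 6 (.get cnt (.lit 0)) :: (recordTriple (.var 0) (.var 1) (.var 2) ++
    (recordTriple (.var 1) (.var 0) (.sub .size (.var 2)) ++ [.store cnt (.lit 0) (.var 6)]))

theorem runs_sizesRecord {P : Program} (hG : G.IsTree) (hM : 2 * (n : ℤ) ≤ M) {u v : Fin n}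
    (h : G.Adj u v) {l : List (Fin n × Fin n)} (hl : l.length + 2 ≤ 2 * (n - 1)) (i w r : ℤ) :
    Runs P A M 34 sizesRecord
      ⟨[((u : ℕ) : ℤ), ((v : ℕ) : ℤ), (dirSize G u v : ℤ), i, w, r, 0], tripleHeap G l⟩
      ⟨[((u : ℕ) : ℤ), ((v : ℕ) : ℤ), (dirSize G u v : ℤ), i, w, r, ((l.length + 2 : ℕ) : ℤ)],
        tripleHeap G (l ++ [(u, v), (v, u)])⟩ := by
  have hswap : (n : ℤ) - dirSize G u v = dirSize G v u := by
    have := dirSize_add_dirSize hG h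
    rw [Fintype.card_fin] at this
    omega
  have hl' : (l ++ [(u, v)]).length = l.length + 1 := by simp
  have hfirst := runs_recordTriple (P := P) (A := A) (G := G) (m := l.length) hM (l := l)
    (loc := [((u : ℕ) : ℤ), ((v : ℕ) : ℤ), (dirSize G u v : ℤ), i, w, r, (l.length : ℤ)])
    (ea := .var 0) (eb := .var 1) (es := .var 2) (by omega) rfl
    (fun _ => rfl) (fun _ => rfl) (fun _ => rfl)
  have hsecond := runs_recordTriple (P := P) (A := A) (G := G) (m := l.length) hM
    (l := l ++ [(u, v)])
    (loc := [((u : ℕ) : ℤ), ((v : ℕ) : ℤ), (dirSize G u v : ℤ), i, w, r,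
      ((l.length + 1 : ℕ) : ℤ)])
    (ea := .var 1) (eb := .var 0) (es := .sub .size (.var 2)) (by omega) (by rw [hl']; rfl)
    (fun _ => rfl) (fun _ => rfl) (fun _ => congrArg some hswap)
  have hcounter : Runs P A M _ [.store cnt (.lit 0) (.var 6)]
      ⟨[((u : ℕ) : ℤ), ((v : ℕ) : ℤ), (dirSize G u v : ℤ), i, w, r, ((l.length + 2 : ℕ) : ℤ)],
        tripleArrays G l.length (l ++ [(u, v)] ++ [(v, u)])⟩
      ⟨[((u : ℕ) : ℤ), ((v : ℕ) : ℤ), (dirSize G u v : ℤ), i, w, r, ((l.length + 2 : ℕ) : ℤ)],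
        tripleArrays G ((l.length + 2 : ℕ) : ℤ) (l ++ [(u, v)] ++ [(v, u)])⟩ :=
    .store (l' := [_]) 0 _ rfl rfl rfl rfl (abs_natCast_le hM (by omega))
  rw [hl'] at hsecond
  rw [tripleHeap, tripleHeap, List.length_append, List.append_cons l]
  exact Runs.mono (.cons (.assign (l.length : ℤ) rfl (by simp) (abs_natCast_le hM (by omega))) <|
    hfirst.append <| hsecond.append hcounter) (by simp [Exp.cost])

/-- Every call `sizes(u, v)` that finds room for its triples records, in `100 * s_u(v) - 25` units
of time, the triples of the edge `uv` and of the edges below it, and it returns `s_u(v)`. -/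
def SizesSpec (G : SimpleGraph (Fin n)) (A : AdjLists n) (M : ℤ) (u v : Fin n) : Prop :=
  ∀ (l : List (Fin n × Fin n)) (loc : List ℤ) (x : ℕ) (eu ev : Exp),
    l.length + 2 * dirSize G u v ≤ 2 * (n - 1) → x < loc.length → eu.cost + ev.cost = 2 →
    eu.eval A loc (tripleHeap G l) = some ((u : ℕ) : ℤ) →
    ev.eval A loc (tripleHeap G l) = some ((v : ℕ) : ℤ) →
    ∃ T : List (Fin n × Fin n), (T : Multiset _) = branchPairs G u v ∧
      Runs computeExpectedPlanar A M (100 * dirSize G u v - 25) [.call x 0 [eu, ev]]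
        ⟨loc, tripleHeap G l⟩ ⟨loc.set x (dirSize G u v : ℤ), tripleHeap G (l ++ T)⟩

/-- The conditional statement in the loop of the procedure `sizes`. -/
def sizesVisit : Stmt :=
  .cond (.ne (.var 4) (.var 0)) [.call 5 0 [.var 1, .var 4], .assign 2 (.add (.var 2) (.var 5))]

theorem runs_sizesVisit (hG : G.IsTree) (hM : 2 * (n : ℤ) ≤ M) {u v w : Fin n} (h : G.Adj v w)
    (hspec : w ≠ u → SizesSpec G A M v w) {l : List (Fin n × Fin n)} {s : ℕ}
    (hl : w ≠ u → l.length + 2 * dirSize G v w ≤ 2 * (n - 1))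
    (hs : w ≠ u → s + dirSize G v w ≤ n) (i r : ℤ) :
    ∃ b T r', b + 15 ≤ (if w = u then 20 else 100 * dirSize G v w) ∧
      ((T : List (Fin n × Fin n)) : Multiset _) = (if w = u then 0 else branchPairs G v w) ∧
      Runs computeExpectedPlanar A M b [sizesVisit]
        ⟨[((u : ℕ) : ℤ), ((v : ℕ) : ℤ), s, i, ((w : ℕ) : ℤ), r, 0], tripleHeap G l⟩
        ⟨[((u : ℕ) : ℤ), ((v : ℕ) : ℤ), ((s + if w = u then 0 else dirSize G v w : ℕ) : ℤ), i,
          ((w : ℕ) : ℤ), r', 0], tripleHeap G (l ++ T)⟩ := by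
  have hpos := dirSize_pos hG.isAcyclic h
  by_cases hwu : w = u
  · simp only [if_pos hwu, add_zero]
    refine ⟨1 + (Test.ne (.var 4) (.var 0)).cost, [], r, by decide, rfl, ?_⟩
    rw [List.append_nil]
    exact .cond_false (by simp [Test.eval, Exp.eval, hwu])
  · simp only [if_neg hwu]
    obtain ⟨T, hT, hcall⟩ := hspec hwu l
      [((u : ℕ) : ℤ), ((v : ℕ) : ℤ), s, i, ((w : ℕ) : ℤ), r, 0] 5 (.var 1) (.var 4) (hl hwu)
      (by simp) rfl rfl rfl
    refine ⟨_, T, dirSize G v w, ?_, hT, .cond_true ?_ (by simp) <|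
      hcall.cons (.assign ((s + dirSize G v w : ℕ) : ℤ) rfl (by simp)
        (abs_natCast_le hM (by have := hs hwu; omega)))⟩
    · simp only [Test.cost, Exp.cost]
      omega
    · simpa [Test.eval, Exp.eval, Fin.ext_iff] using hwu

/-- The body of the loop of the procedure `sizes`. -/
def sizesLoopBody : List Stmt :=
  [.assign 4 (.nbr (.var 1) (.var 3)), sizesVisit, .assign 3 (.add (.var 3) (.lit 1))]

theorem runs_sizesLoopBody (hG : G.IsTree) (hA : A.Represents G) (hM : 2 * (n : ℤ) ≤ M)
    {u v : Fin n} {i : ℕ} (hi : i < (A v).length)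
    (hspec : (A v)[i] ≠ u → SizesSpec G A M v (A v)[i]) {l : List (Fin n × Fin n)} {s : ℕ}
    (hl : (A v)[i] ≠ u → l.length + 2 * dirSize G v (A v)[i] ≤ 2 * (n - 1))
    (hs : (A v)[i] ≠ u → s + dirSize G v (A v)[i] ≤ n) (w r : ℤ) :
    ∃ b T r', b + 5 ≤ (if (A v)[i] = u then 20 else 100 * dirSize G v (A v)[i]) ∧
      ((T : List (Fin n × Fin n)) : Multiset _) =
        (if (A v)[i] = u then 0 else branchPairs G v (A v)[i]) ∧
      Runs computeExpectedPlanar A M b sizesLoopBody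
        ⟨[((u : ℕ) : ℤ), ((v : ℕ) : ℤ), s, i, w, r, 0], tripleHeap G l⟩
        ⟨[((u : ℕ) : ℤ), ((v : ℕ) : ℤ),
          ((s + if (A v)[i] = u then 0 else dirSize G v (A v)[i] : ℕ) : ℤ), ((i + 1 : ℕ) : ℤ),
          (((A v)[i] : ℕ) : ℤ), r', 0], tripleHeap G (l ++ T)⟩ := by
  have hadj : G.Adj v (A v)[i] := ((hA v).2 _).1 (List.getElem_mem hi)
  have hlength := hA.length_le v
  obtain ⟨b, T, r', hb, hT, hvisit⟩ := runs_sizesVisit hG hM hadj hspec hl hs i r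
  refine ⟨_, T, r', ?_, hT, .cons (.assign (((A v)[i] : ℕ) : ℤ) (nbrAt_coe A v hi) (by simp)
    (abs_natCast_le hM (by omega))) <| hvisit.cons <|
    .assign ((i + 1 : ℕ) : ℤ) rfl (by simp) (abs_natCast_le hM (by omega))⟩
  simp only [Exp.cost]
  omega

theorem sum_take_ite_dirSize_le (hG : G.IsTree) (hA : A.Represents G) {u v : Fin n}
    (h : G.Adj u v) (i : ℕ) :
    1 + (((A v).take i).map fun w => if w = u then 0 else dirSize G v w).sum ≤ dirSize G u v := by
  classical
  rw [dirSize_eq hG h, ← zero_add (∑ w ∈ _, _), ← hA.sum_map_ite h.symm]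
  exact Nat.add_le_add_left (sum_map_take_le _ _ i) 1

/-- The loop invariant of the procedure `sizes`, for the arguments `u`, `v` and the triples `l` at
the beginning: what the memory may be after the first `i` neighbours of `v`. -/
def SizesInvariant (G : SimpleGraph (Fin n)) (A : AdjLists n) (u v : Fin n)
    (l : List (Fin n × Fin n)) (i : ℕ) (μ : Memory) : Prop :=
  ∃ (T : List (Fin n × Fin n)) (s : ℕ) (w r : ℤ),
    (T : Multiset _) = (((A v).take i).map fun w => if w = u then 0 else branchPairs G v w).sum ∧
    T.length + 2 = 2 * s ∧
    s = 1 + (((A v).take i).map fun w => if w = u then 0 else dirSize G v w).sum ∧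
    μ = ⟨[((u : ℕ) : ℤ), ((v : ℕ) : ℤ), (s : ℤ), (i : ℤ), w, r, 0], tripleHeap G (l ++ T)⟩

theorem SizesInvariant.succ (hG : G.IsTree) (hA : A.Represents G) (hM : 2 * (n : ℤ) ≤ M)
    {u v : Fin n} (h : G.Adj u v) (hspec : ∀ w ∈ A v, w ≠ u → SizesSpec G A M v w)
    {l : List (Fin n × Fin n)} (hl : l.length + 2 * dirSize G u v ≤ 2 * (n - 1)) {i : ℕ}
    (hi : i < (A v).length) {μ : Memory} (hμ : SizesInvariant G A u v l i μ) :
    ∃ b μ', b + 5 ≤ (if (A v)[i] = u then 20 else 100 * dirSize G v (A v)[i]) ∧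
      SizesInvariant G A u v l (i + 1) μ' ∧
      Runs computeExpectedPlanar A M b sizesLoopBody μ μ' := by
  obtain ⟨T, s, w, r, hT, hlength, hs, rfl⟩ := hμ
  have hle : dirSize G u v ≤ n := by simpa using dirSize_le G u v
  have hnext := sum_take_ite_dirSize_le hG hA h (i + 1)
  rw [sum_map_take_succ _ hi, ← add_assoc, ← hs] at hnext
  obtain ⟨b, T', r', hb, hT', hbody⟩ := runs_sizesLoopBody hG hA hM hi
    (hspec _ (List.getElem_mem hi)) (l := l ++ T) (s := s)
    (fun hne => by rw [if_neg hne] at hnext; rw [List.length_append]; omega)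
    (fun hne => by rw [if_neg hne] at hnext; omega) w r
  refine ⟨b, _, hb, ⟨T ++ T', _, _, r', ?_, ?_, ?_, rfl⟩, by rwa [← List.append_assoc]⟩
  · rw [← Multiset.coe_add, hT, hT', sum_map_take_succ _ hi]
  · have hcard := congrArg Multiset.card hT'
    rw [Multiset.coe_card] at hcard
    rw [List.length_append]
    split_ifs at hcard ⊢
    · rw [Multiset.card_zero] at hcard
      omega
    · rw [card_branchPairs] at hcard
      omega
  · rw [sum_map_take_succ _ hi, hs, add_assoc]

theorem runs_sizesLoop (hG : G.IsTree) (hA : A.Represents G) (hM : 2 * (n : ℤ) ≤ M)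
    {u v : Fin n} (h : G.Adj u v) (hspec : ∀ w ∈ A v, w ≠ u → SizesSpec G A M v w)
    {l : List (Fin n × Fin n)} (hl : l.length + 2 * dirSize G u v ≤ 2 * (n - 1)) :
    ∃ (T : List (Fin n × Fin n)) (i w r : ℤ), T.length + 2 = 2 * dirSize G u v ∧
      {(u, v), (v, u)} + (T : Multiset _) = branchPairs G u v ∧
      Runs computeExpectedPlanar A M (100 * dirSize G u v - 75)
        [.loop (.lt (.var 3) (.deg (.var 1))) sizesLoopBody]
        ⟨[((u : ℕ) : ℤ), ((v : ℕ) : ℤ), 1, 0, 0, 0, 0], tripleHeap G l⟩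
        ⟨[((u : ℕ) : ℤ), ((v : ℕ) : ℤ), (dirSize G u v : ℤ), i, w, r, 0],
          tripleHeap G (l ++ T)⟩ := by
  classical
  have hinit : SizesInvariant G A u v l 0
      ⟨[((u : ℕ) : ℤ), ((v : ℕ) : ℤ), 1, 0, 0, 0, 0], tripleHeap G l⟩ :=
    ⟨[], 1, 0, 0, rfl, rfl, rfl, by rw [List.append_nil]; rfl⟩
  obtain ⟨_, ⟨T, s, w, r, hT, hlength, hs, rfl⟩, hloop⟩ :=
    Runs.exists_loop (P := computeExpectedPlanar) (A := A) (M := M) (m := (A v).length)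
      (c := .lt (.var 3) (.deg (.var 1))) (body := sizesLoopBody) (SizesInvariant G A u v l)
      (fun i => (((A v).take i).map fun w => if w = u then 20 else 100 * dirSize G v w).sum)
      (by decide) hinit
      (fun i hi μ hμ => by
        obtain ⟨b, μ', hb, hμ', hbody⟩ := hμ.succ hG hA hM h hspec hl hi
        obtain ⟨_, _, _, _, -, -, -, rfl⟩ := hμ
        refine ⟨by simp [Test.eval, Exp.eval, degAt_coe, hi], b, μ', ?_, hμ', hbody⟩
        rw [sum_map_take_succ _ hi]
        simp only [Test.cost, Exp.cost]
        omega)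
      (fun μ hμ => by
        obtain ⟨_, _, _, _, -, -, -, rfl⟩ := hμ
        simp [Test.eval, Exp.eval, degAt_coe])
  rw [List.take_length] at hT hs hloop
  rw [hA.sum_map_ite h.symm] at hT hs hloop
  rw [zero_add] at hT hs
  rw [← dirSize_eq hG h] at hs
  subst hs
  refine ⟨T, _, w, r, hlength, by rw [hT, ← branchPairs_eq hG h], hloop.mono ?_⟩
  have hsum := dirSize_eq hG h
  simp only [Test.cost, Exp.cost, ← Finset.mul_sum]
  omega

theorem runs_sizesProc (hG : G.IsTree) (hA : A.Represents G) (hM : 2 * (n : ℤ) ≤ M)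
    {u v : Fin n} (h : G.Adj u v) (hspec : ∀ w ∈ A v, w ≠ u → SizesSpec G A M v w)
    {l : List (Fin n × Fin n)} (hl : l.length + 2 * dirSize G u v ≤ 2 * (n - 1)) :
    ∃ (T : List (Fin n × Fin n)) (i w r k : ℤ), (T : Multiset _) = branchPairs G u v ∧
      Runs computeExpectedPlanar A M (100 * dirSize G u v - 37)
        ([.assign 2 (.lit 1), .assign 3 (.lit 0),
          .loop (.lt (.var 3) (.deg (.var 1))) sizesLoopBody] ++ sizesRecord)
        ⟨[((u : ℕ) : ℤ), ((v : ℕ) : ℤ), 0, 0, 0, 0, 0], tripleHeap G l⟩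
        ⟨[((u : ℕ) : ℤ), ((v : ℕ) : ℤ), (dirSize G u v : ℤ), i, w, r, k],
          tripleHeap G (l ++ T)⟩ := by
  have hpos := dirSize_pos hG.isAcyclic h
  have hle : dirSize G u v ≤ n := by simpa using dirSize_le G u v
  obtain ⟨T, i, w, r, hlength, hT, hloop⟩ := runs_sizesLoop hG hA hM h hspec hl
  have hrecord := runs_sizesRecord (P := computeExpectedPlanar) (A := A) hG hM h (l := l ++ T)
    (by rw [List.length_append]; omega) i w r
  refine ⟨T ++ [(u, v), (v, u)], i, w, r, ((l ++ T).length + 2 : ℕ), ?_, ?_⟩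
  · rw [← Multiset.coe_add, ← hT, add_comm]
    rfl
  · rw [← List.append_assoc]
    exact (Runs.append (.cons (.assign 1 rfl (by simp) (by simp; omega)) <|
      .cons (.assign 0 rfl (by simp) (by simp; omega)) hloop) hrecord).mono
        (by simp only [Exp.cost]; omega)

theorem sizesSpec_of_adj (hG : G.IsTree) (hA : A.Represents G) (hM : 2 * (n : ℤ) ≤ M)
    {u v : Fin n} (h : G.Adj u v) : SizesSpec G A M u v := by
  classical
  have hspec : ∀ w ∈ A v, w ≠ u → SizesSpec G A M v w := fun w hw hwu =>
    have hadj : G.Adj v w := ((hA v).2 w).1 hw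
    have : dirSize G v w < dirSize G u v := by
      rw [dirSize_eq hG h, Nat.lt_one_add_iff]
      exact Finset.single_le_sum (f := fun w => dirSize G v w) (fun _ _ => Nat.zero_le _)
        (Finset.mem_erase.2 ⟨hwu, (G.mem_neighborFinset v w).2 hadj⟩)
    sizesSpec_of_adj hG hA hM hadj
  intro l loc x eu ev hl hx hcost hu hv
  have hle : dirSize G u v ≤ n := by simpa using dirSize_le G u v
  have hvertex : ∀ w : Fin n, |((w : ℕ) : ℤ)| ≤ M := fun w => abs_natCast_le hM (by omega)
  obtain ⟨T, i, w, r, k, hT, hbody⟩ := runs_sizesProc hG hA hM h hspec hl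
  have hcall := Runs.call (p := 0) (args := [eu, ev]) (μ := ⟨loc, tripleHeap G l⟩)
    (zs := [((u : ℕ) : ℤ), ((v : ℕ) : ℤ)]) (q := sizesProc) rfl (e := .var 2) rfl (by decide)
    (by simp [evalArgs, hu, hv]) (Nat.le_add_left 2 5) (by omega)
    (by simpa using And.intro (hvertex u) (hvertex v)) hx hbody rfl
    (abs_natCast_le hM (by omega))
  have hpos := dirSize_pos hG.isAcyclic h
  refine ⟨T, hT, hcall.mono ?_⟩
  simp only [List.map_cons, List.map_nil, List.sum_cons, List.sum_nil, sizesProc, Exp.cost]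
  omega
termination_by dirSize G u v

end Sizes

/-! ### The main procedure -/

section Main

variable {n : ℕ} {G : SimpleGraph (Fin n)} {A : AdjLists n} {M : ℤ}

/-- The body of the loop of the main procedure over the neighbours of the vertex `0`. -/
def callLoopBody : List Stmt :=
  [.assign 1 (.nbr (.lit 0) (.var 0)), .call 2 0 [.lit 0, .var 1],
    .assign 0 (.add (.var 0) (.lit 1))]

/-- The loop invariant of the calls of `sizes`: what the memory may be after the first `i`
neighbours of the vertex `0`. -/
def CallInvariant [NeZero n] (G : SimpleGraph (Fin n)) (A : AdjLists n) (i : ℕ) (μ : Memory) :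
    Prop :=
  ∃ (T : List (Fin n × Fin n)) (w r : ℤ),
    (T : Multiset _) = (((A 0).take i).map (branchPairs G 0)).sum ∧
    T.length = 2 * (((A 0).take i).map (dirSize G 0)).sum ∧
    μ = ⟨[(i : ℤ), w, r, 0, 0, 0, 0, 0], tripleHeap G T⟩

theorem AdjLists.Represents.sum_map_dirSize (hG : G.IsTree) (hA : A.Represents G) (u : Fin n) :
    ((A u).map (dirSize G u)).sum = n - 1 := by
  classical
  rw [hA.sum_map, sum_dirSize hG.connected, Fintype.card_fin]

theorem CallInvariant.succ [NeZero n] (hG : G.IsTree) (hA : A.Represents G)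
    (hM : 2 * (n : ℤ) ≤ M) {i : ℕ} (hi : i < (A 0).length) {μ : Memory}
    (hμ : CallInvariant G A i μ) :
    ∃ b μ', b + 5 ≤ 100 * dirSize G 0 (A 0)[i] ∧ CallInvariant G A (i + 1) μ' ∧
      Runs computeExpectedPlanar A M b callLoopBody μ μ' := by
  obtain ⟨T, w, r, hT, hlength, rfl⟩ := hμ
  have hadj : G.Adj 0 (A 0)[i] := ((hA 0).2 _).1 (List.getElem_mem hi)
  have hpos := dirSize_pos hG.isAcyclic hadj
  have hdegree := hA.length_le 0
  have hroom := sum_map_take_le (dirSize G 0) (A 0) (i + 1)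
  rw [sum_map_take_succ _ hi, hA.sum_map_dirSize hG] at hroom
  have hread := nbrAt_coe A 0 hi
  rw [Fin.val_zero, Nat.cast_zero] at hread
  obtain ⟨T', hT', hcall⟩ := sizesSpec_of_adj hG hA hM hadj T
    [(i : ℤ), (((A 0)[i] : ℕ) : ℤ), r, 0, 0, 0, 0, 0] 2 (.lit 0) (.var 1) (by omega) (by simp) rfl
    (by simp [Exp.eval]) rfl
  refine ⟨_, _, ?_, ⟨T ++ T', (((A 0)[i] : ℕ) : ℤ), (dirSize G 0 (A 0)[i] : ℤ), ?_, ?_, rfl⟩,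
    .cons (.assign (((A 0)[i] : ℕ) : ℤ) hread (by simp) (abs_natCast_le hM (by omega))) <|
      hcall.cons (.assign ((i + 1 : ℕ) : ℤ) rfl (by simp) (abs_natCast_le hM (by omega)))⟩
  · simp only [Exp.cost]
    omega
  · rw [← Multiset.coe_add, hT, hT', sum_map_take_succ _ hi]
  · have hcard := congrArg Multiset.card hT'
    rw [Multiset.coe_card, card_branchPairs] at hcard
    rw [List.length_append, hlength, hcard, sum_map_take_succ _ hi, mul_add]

theorem runs_callLoop [NeZero n] [DecidableRel G.Adj] (hG : G.IsTree) (hA : A.Represents G)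
    (hM : 2 * (n : ℤ) ≤ M) :
    ∃ (T : List (Fin n × Fin n)) (i w r : ℤ), T.length = 2 * (n - 1) ∧
      (T : Multiset _) = ∑ u, ∑ v ∈ G.neighborFinset u, {(u, v)} ∧
      Runs computeExpectedPlanar A M (100 * (n - 1) + 5)
        [.loop (.lt (.var 0) (.deg (.lit 0))) callLoopBody]
        ⟨[0, 0, 0, 0, 0, 0, 0, 0], tripleHeap G []⟩ ⟨[i, w, r, 0, 0, 0, 0, 0], tripleHeap G T⟩ := by
  have hdegree := degAt_coe A 0
  rw [Fin.val_zero, Nat.cast_zero] at hdegree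
  obtain ⟨_, ⟨T, w, r, hT, hlength, rfl⟩, hloop⟩ :=
    Runs.exists_loop (P := computeExpectedPlanar) (A := A) (M := M) (m := (A 0).length)
      (μ := ⟨[0, 0, 0, 0, 0, 0, 0, 0], tripleHeap G []⟩)
      (c := .lt (.var 0) (.deg (.lit 0))) (body := callLoopBody) (CallInvariant G A)
      (fun i => (((A 0).take i).map fun w => 100 * dirSize G 0 w).sum)
      (by decide) ⟨[], 0, 0, rfl, rfl, rfl⟩
      (fun i hi μ hμ => by
        obtain ⟨b, μ', hb, hμ', hbody⟩ := hμ.succ hG hA hM hi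
        obtain ⟨_, _, _, -, -, rfl⟩ := hμ
        refine ⟨by simp [Test.eval, Exp.eval, hdegree, hi], b, μ', ?_, hμ', hbody⟩
        rw [sum_map_take_succ _ hi]
        simp only [Test.cost, Exp.cost]
        omega)
      (fun μ hμ => by
        obtain ⟨_, _, _, -, -, rfl⟩ := hμ
        simp [Test.eval, Exp.eval, hdegree])
  rw [List.take_length] at hT hlength hloop
  refine ⟨T, _, w, r, by rw [hlength, hA.sum_map_dirSize hG], ?_, hloop.mono ?_⟩
  · rw [hT, hA.sum_map, sum_branchPairs hG]
  · rw [List.sum_map_mul_left, hA.sum_map_dirSize hG]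
    simp [Test.cost, Exp.cost]

/-- The part of the main procedure that computes the triples. -/
def triplesCode : List Stmt :=
  [.alloc cnt (.lit 1), .alloc src (.mul (.lit 2) (.sub .size (.lit 1))),
    .alloc dst (.mul (.lit 2) (.sub .size (.lit 1))),
    .alloc siz (.mul (.lit 2) (.sub .size (.lit 1))), .assign 0 (.lit 0),
    .loop (.lt (.var 0) (.deg (.lit 0))) callLoopBody]

theorem runs_triplesCode [NeZero n] [DecidableRel G.Adj] (hG : G.IsTree) (hA : A.Represents G)
    (hM : 2 * (n : ℤ) ≤ M) :
    ∃ (T : List (Fin n × Fin n)) (i w r : ℤ), T.length = 2 * (n - 1) ∧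
      (T : Multiset _) = ∑ u, ∑ v ∈ G.neighborFinset u, {(u, v)} ∧
      Runs computeExpectedPlanar A M (106 * n) triplesCode
        ⟨List.replicate 8 0, List.replicate 5 []⟩ ⟨[i, w, r, 0, 0, 0, 0, 0], tripleHeap G T⟩ := by
  have hn : 1 ≤ n := NeZero.one_le
  have hM0 : 0 ≤ M := by omega
  have hsize : ∀ heap, (Exp.mul (.lit 2) (.sub .size (.lit 1))).eval A (List.replicate 8 0) heap =
      some ((2 * (n - 1) : ℕ) : ℤ) := fun heap => by
    push_cast [hn]
    rfl
  have hinit : tripleHeap G [] = [[0], List.replicate (2 * (n - 1)) 0,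
      List.replicate (2 * (n - 1)) 0, List.replicate (2 * (n - 1)) 0, []] := by
    simp [tripleHeap, tripleArrays, pad]
  obtain ⟨T, i, w, r, hlength, hT, hloop⟩ := runs_callLoop hG hA hM
  rw [hinit] at hloop
  refine ⟨T, i, w, r, hlength, hT, .mono (.cons (.alloc 1 rfl (by simp) hM0) <|
    .cons (.alloc _ (hsize _) (by simp) hM0) <|
    .cons (.alloc _ (hsize _) (by simp [dst]) hM0) <|
    .cons (.alloc _ (hsize _) (by simp [siz]) hM0) <|
    .cons (.assign 0 rfl (by simp) (by simpa using hM0)) hloop) ?_⟩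
  simp only [Exp.cost]
  omega

end Main

section Squares

variable {n : ℕ} {G : SimpleGraph (Fin n)} {A : AdjLists n} {M : ℤ}

/-- The vector `L` of the algorithm after the triples for the pairs in `l` have been processed. -/
noncomputable def squares (G : SimpleGraph (Fin n)) (l : List (Fin n × Fin n)) (v : Fin n) : ℤ :=
  (l.map fun p => if p.1 = v then (dirSize G p.1 p.2 : ℤ) ^ 2 else 0).sum

theorem squares_eq_sumSq [DecidableRel G.Adj] {l : List (Fin n × Fin n)}
    (hl : (l : Multiset _) = ∑ u, ∑ v ∈ G.neighborFinset u, {(u, v)}) :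
    squares G l = sumSq G := by
  funext v
  rw [squares, ← Multiset.sum_coe, ← Multiset.map_coe, hl, ← Multiset.coe_mapAddMonoidHom,
    ← Multiset.coe_sumAddMonoidHom, map_sum, map_sum,
    Finset.sum_eq_single_of_mem v (Finset.mem_univ v) fun u _ hu => by
      simp [hu, Multiset.nsmul_singleton]]
  simp [sumSq]

theorem squares_take_le (l : List (Fin n × Fin n)) (i : ℕ) (v : Fin n) :
    squares G (l.take i) v ≤ squares G l v :=
  ((List.take_sublist i l).map _).sum_le_sum fun x hx => by
    obtain ⟨p, -, rfl⟩ := List.mem_map.1 hx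
    positivity

theorem squares_nonneg (l : List (Fin n × Fin n)) (v : Fin n) : 0 ≤ squares G l v :=
  squares_take_le l 0 v

theorem squares_take_succ {l : List (Fin n × Fin n)} {i : ℕ} (hi : i < l.length) :
    squares G (l.take (i + 1)) = Function.update (squares G (l.take i)) l[i].1
      (squares G (l.take i) l[i].1 + dirSize G l[i].1 l[i].2 * dirSize G l[i].1 l[i].2) := by
  funext v
  rw [squares, sum_map_take_succ _ hi, Function.update_apply]
  split_ifs with h h' h'
  · rw [h', squares, sq]
  · exact absurd h.symm h'
  · exact absurd h'.symm h
  · rw [squares, add_zero]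

/-- The working arrays that represent the triples `(a, b, s_a(b))` for the pairs `(a, b)` in `l`,
and the vector `f`. -/
noncomputable def fullHeap (G : SimpleGraph (Fin n)) (l : List (Fin n × Fin n))
    (f : Fin n → ℤ) : List (List ℤ) := (tripleHeap G l).set acc (List.ofFn f)

/-- The body of the loop of the main procedure over the triples. -/
def squareLoopBody : List Stmt :=
  [.assign 4 (.get src (.var 3)),
    .store acc (.var 4) (.add (.get acc (.var 4)) (.mul (.get siz (.var 3)) (.get siz (.var 3)))),
    .assign 3 (.add (.var 3) (.lit 1))]

theorem runs_squareLoopBody {P : Program} (hM : 2 * (n : ℤ) ≤ M) {l : List (Fin n × Fin n)}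
    (hl : l.length ≤ 2 * (n - 1)) (hsquares : ∀ v, squares G l v ≤ M) {i : ℕ} (hi : i < l.length)
    (a w r u : ℤ) :
    Runs P A M 17 squareLoopBody
      ⟨[a, w, r, (i : ℤ), u, 0, 0, 0], fullHeap G l (squares G (l.take i))⟩
      ⟨[a, w, r, ((i + 1 : ℕ) : ℤ), ((l[i].1 : ℕ) : ℤ), 0, 0, 0],
        fullHeap G l (squares G (l.take (i + 1)))⟩ := by
  have hread : ∀ f : Fin n × Fin n → ℤ,
      readAt (pad (2 * (n - 1)) (l.map f)) i = some (f l[i]) := fun f => by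
    rw [readAt_pad (by simpa using hi), List.getElem_map]
  have hvalue : |squares G (l.take i) l[i].1 +
      dirSize G l[i].1 l[i].2 * dirSize G l[i].1 l[i].2| ≤ M := by
    have h := squares_take_le (G := G) l (i + 1) l[i].1
    have h0 := squares_nonneg (G := G) (l.take (i + 1)) l[i].1
    rw [squares_take_succ hi, Function.update_self] at h h0
    rw [abs_of_nonneg h0]
    exact h.trans (hsquares _)
  rw [squares_take_succ hi]
  exact Runs.mono (.cons (.assign ((l[i].1 : ℕ) : ℤ) (hread _) (by simp)
      (abs_natCast_le hM (by omega))) <|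
    .cons (.store (l := List.ofFn (squares G (l.take i))) _ _ rfl
      (by simp [Exp.eval, fullHeap, tripleHeap, tripleArrays, readAt_ofFn, hread]) rfl
      (writeAt_ofFn _ _ _) hvalue) <|
    .assign ((i + 1 : ℕ) : ℤ) rfl (by simp) (abs_natCast_le hM (by omega))) (by simp [Exp.cost])

/-- The part of the main procedure that sums up the squares of the sizes at each vertex. -/
def squaresCode : List Stmt :=
  [.alloc acc .size, .assign 3 (.lit 0),
    .loop (.lt (.var 3) (.get cnt (.lit 0))) squareLoopBody]

theorem runs_squaresCode {P : Program} [NeZero n] (hM : 2 * (n : ℤ) ≤ M)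
    {l : List (Fin n × Fin n)} (hl : l.length ≤ 2 * (n - 1)) (hsquares : ∀ v, squares G l v ≤ M)
    (a w r : ℤ) :
    ∃ i u : ℤ, Runs P A M (45 * n) squaresCode ⟨[a, w, r, 0, 0, 0, 0, 0], tripleHeap G l⟩
      ⟨[a, w, r, i, u, 0, 0, 0], fullHeap G l (squares G l)⟩ := by
  have hn : 1 ≤ n := NeZero.one_le
  have hM0 : 0 ≤ M := by omega
  have hzero : (tripleHeap G l).set acc (List.replicate n 0) =
      fullHeap G l (squares G (l.take 0)) := by
    rw [fullHeap, ← List.ofFn_const]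
    rfl
  obtain ⟨_, ⟨u, rfl⟩, hloop⟩ := Runs.exists_loop (P := P) (A := A) (M := M) (m := l.length)
    (μ := ⟨[a, w, r, 0, 0, 0, 0, 0], fullHeap G l (squares G (l.take 0))⟩)
    (c := .lt (.var 3) (.get cnt (.lit 0))) (body := squareLoopBody)
    (fun i μ => ∃ u : ℤ,
      μ = ⟨[a, w, r, (i : ℤ), u, 0, 0, 0], fullHeap G l (squares G (l.take i))⟩)
    (fun i => 22 * i) (by decide) ⟨0, rfl⟩
    (fun i hi μ ⟨u, hμ⟩ => hμ ▸ ⟨congrArg some (decide_eq_true (Nat.cast_lt.2 hi)), 17, _,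
      by simp only [Test.cost, Exp.cost]; omega, ⟨_, rfl⟩,
      runs_squareLoopBody hM hl hsquares hi a w r u⟩)
    (fun μ ⟨_, hμ⟩ => hμ ▸ congrArg some (decide_eq_false (lt_irrefl _)))
  rw [List.take_length, ← hzero] at hloop
  refine ⟨_, u, .mono (.cons (.alloc n rfl (by simp [tripleHeap, tripleArrays]) hM0) <|
    .cons (.assign 0 rfl (by simp) (by simpa using hM0)) hloop) ?_⟩
  simp only [Test.cost, Exp.cost]
  omega

end Squares

section Degrees

variable {n : ℕ} {G : SimpleGraph (Fin n)} {A : AdjLists n} {M : ℤ}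

theorem sum_filter_lt_succ {j : ℕ} (hj : j < n) (g : Fin n → ℤ) :
    ∑ v : Fin n with v.val < j + 1, g v = ∑ v : Fin n with v.val < j, g v + g ⟨j, hj⟩ := by
  have hsplit : Finset.univ.filter (fun v : Fin n => v.val < j + 1) =
      insert ⟨j, hj⟩ (Finset.univ.filter fun v => v.val < j) := by
    ext v
    simp only [Finset.mem_filter_univ, Finset.mem_insert, Fin.ext_iff]
    omega
  rw [hsplit, Finset.sum_insert (by simp), add_comm]

/-- The body of the loop of the main procedure over the vertices. -/
def degreeLoopBody : List Stmt :=
  [.assign 5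
      (.add (.var 5) (.mul (.sub (.mul (.lit 2) (.deg (.var 4))) (.lit 1)) (.get acc (.var 4)))),
    .assign 4 (.add (.var 4) (.lit 1))]

theorem runs_degreeLoopBody {P : Program} (hM : 2 * (n : ℤ) ≤ M) {l : List (Fin n × Fin n)}
    {f g : Fin n → ℤ} (hg : ∀ v, (2 * ((A v).length : ℤ) - 1) * f v = g v)
    (hsum : ∑ v, |g v| ≤ M) {j : ℕ} (hj : j < n) (a w r i : ℤ) :
    Runs P A M 16 degreeLoopBody
      ⟨[a, w, r, i, (j : ℤ), ∑ v : Fin n with v.val < j, g v, 0, 0], fullHeap G l f⟩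
      ⟨[a, w, r, i, ((j + 1 : ℕ) : ℤ), ∑ v : Fin n with v.val < j + 1, g v, 0, 0],
        fullHeap G l f⟩ := by
  have hdegree : degAt A j = some ((A ⟨j, hj⟩).length : ℤ) := degAt_coe A ⟨j, hj⟩
  have hread : readAt (List.ofFn f) j = some (f ⟨j, hj⟩) := readAt_ofFn f ⟨j, hj⟩
  refine Runs.mono (.cons (.assign (∑ v : Fin n with v.val < j + 1, g v) ?_ (by simp) ?_) <|
    .assign ((j + 1 : ℕ) : ℤ) rfl (by simp) (abs_natCast_le hM (by omega))) (by simp [Exp.cost])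
  · rw [sum_filter_lt_succ hj, ← hg]
    simp [Exp.eval, fullHeap, tripleHeap, tripleArrays, hdegree, hread]
  · exact (Finset.abs_sum_le_sum_abs _ _).trans <| hsum.trans' <|
      Finset.sum_le_sum_of_subset_of_nonneg (Finset.filter_subset _ _) fun _ _ _ => abs_nonneg _

/-- The part of the main procedure that computes the sum over the vertices. -/
def degreesCode : List Stmt :=
  [.assign 4 (.lit 0), .assign 5 (.lit 0), .loop (.lt (.var 4) .size) degreeLoopBody]

theorem runs_degreesCode {P : Program} (hM : 2 * (n : ℤ) ≤ M) {l : List (Fin n × Fin n)}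
    {f g : Fin n → ℤ} (hg : ∀ v, (2 * ((A v).length : ℤ) - 1) * f v = g v)
    (hsum : ∑ v, |g v| ≤ M) (a w r i u : ℤ) :
    Runs P A M (20 * n + 8) degreesCode
      ⟨[a, w, r, i, u, 0, 0, 0], fullHeap G l f⟩
      ⟨[a, w, r, i, (n : ℤ), ∑ v, g v, 0, 0], fullHeap G l f⟩ := by
  have hM0 : 0 ≤ M := by omega
  obtain ⟨_, rfl, hloop⟩ := Runs.exists_loop (P := P) (A := A) (M := M) (m := n)
    (μ := ⟨[a, w, r, i, 0, 0, 0, 0], fullHeap G l f⟩)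
    (c := .lt (.var 4) .size) (body := degreeLoopBody)
    (fun j μ => μ =
      ⟨[a, w, r, i, (j : ℤ), ∑ v : Fin n with v.val < j, g v, 0, 0], fullHeap G l f⟩)
    (fun j => 20 * j) (by decide) (by simp)
    (fun j hj μ hμ => hμ ▸ ⟨congrArg some (decide_eq_true (Nat.cast_lt.2 hj)), 16, _,
      by simp only [Test.cost, Exp.cost]; omega, rfl,
      runs_degreeLoopBody hM hg hsum hj a w r i⟩)
    (fun μ hμ => hμ ▸ congrArg some (decide_eq_false (lt_irrefl _)))
  rw [Finset.filter_true_of_mem fun v _ => v.2] at hloop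
  refine .mono (.cons (.assign 0 rfl (by simp) (by simpa using hM0)) <|
    .cons (.assign 0 rfl (by simp) (by simpa using hM0)) hloop) ?_
  simp only [Test.cost, Exp.cost]
  omega

/-- The part of the main procedure that computes the numerator and the denominator. -/
def resultCode : List Stmt :=
  [.assign 6
      (.sub
        (.mul (.sub .size (.lit 1))
          (.sub (.add (.mul (.lit 3) (.mul .size .size)) (.mul (.lit 2) .size)) (.lit 2)))
        (.var 5)),
    .assign 7 (.mul (.lit 6) .size)]

theorem runs_resultCode {P : Program} [NeZero n] (hM : 10 * (n : ℤ) ^ 3 ≤ M) {t : ℤ}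
    (ht : |t| ≤ 5 * (n : ℤ) ^ 3) (a w r i u : ℤ) (heap : List (List ℤ)) :
    Runs P A M 22 resultCode ⟨[a, w, r, i, u, t, 0, 0], heap⟩
      ⟨[a, w, r, i, u, t, (n - 1) * (3 * n ^ 2 + 2 * n - 2) - t, 6 * n], heap⟩ := by
  have hn : (1 : ℤ) ≤ n := by exact_mod_cast NeZero.one_le (n := n)
  have hn3 : (n : ℤ) ≤ (n : ℤ) ^ 3 := le_self_pow₀ hn (by norm_num)
  refine Runs.mono (.cons (.assign (((n : ℤ) - 1) * (3 * n ^ 2 + 2 * n - 2) - t) ?_ (by simp) ?_) <|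
    .assign (6 * (n : ℤ)) rfl (by simp) ?_) (by simp [Exp.cost])
  · simp [Exp.eval, sq]
  · have hnonneg : 0 ≤ ((n : ℤ) - 1) * (3 * n ^ 2 + 2 * n - 2) :=
      mul_nonneg (by linarith) (by nlinarith)
    have hle : ((n : ℤ) - 1) * (3 * n ^ 2 + 2 * n - 2) ≤ 5 * (n : ℤ) ^ 3 := by nlinarith
    rw [abs_le] at ht ⊢
    constructor <;> linarith
  · rw [abs_of_nonneg (by positivity)]
    linarith

theorem sumSq_le [DecidableRel G.Adj] (hG : G.IsTree) (u : Fin n) : sumSq G u ≤ (n : ℤ) ^ 2 := by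
  have hsize : ∑ w ∈ G.neighborFinset u, (dirSize G u w : ℤ) ≤ n := by
    rw [← Nat.cast_sum, sum_dirSize hG.connected, Fintype.card_fin]
    exact_mod_cast n.sub_le 1
  calc sumSq G u ≤ (∑ w ∈ G.neighborFinset u, (dirSize G u w : ℤ)) ^ 2 :=
        Finset.sum_sq_le_sq_sum_of_nonneg fun w _ => Int.natCast_nonneg _
    _ ≤ (n : ℤ) ^ 2 := by gcongr

theorem sum_abs_degree_mul_sumSq_le [DecidableRel G.Adj] (hG : G.IsTree) :
    ∑ u, |(2 * (G.degree u : ℤ) - 1) * sumSq G u| ≤ 5 * (n : ℤ) ^ 3 := by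
  have hterm : ∀ u, |(2 * (G.degree u : ℤ) - 1) * sumSq G u| ≤
      (2 * (G.degree u : ℤ) + 1) * (n : ℤ) ^ 2 := fun u => by
    have hnonneg : 0 ≤ sumSq G u := Finset.sum_nonneg fun w _ => sq_nonneg _
    rw [abs_mul, abs_of_nonneg hnonneg]
    gcongr
    · exact abs_le.2 (by omega)
    · exact sumSq_le hG u
  calc ∑ u, |(2 * (G.degree u : ℤ) - 1) * sumSq G u|
      ≤ ∑ u, (2 * (G.degree u : ℤ) + 1) * (n : ℤ) ^ 2 := Finset.sum_le_sum fun u _ => hterm u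
    _ = (5 * n - 4) * (n : ℤ) ^ 2 := by
        rw [← Finset.sum_mul, Finset.sum_add_distrib, ← Finset.mul_sum, sum_degree hG]
        simp only [Finset.sum_const, Finset.card_univ, Fintype.card_fin, nsmul_eq_mul, mul_one]
        ring
    _ ≤ 5 * (n : ℤ) ^ 3 := by nlinarith [sq_nonneg (n : ℤ)]

end Degrees

section Correctness

variable {n : ℕ} {G : SimpleGraph (Fin n)} {A : AdjLists n} {M : ℤ}

theorem mainProc_body :
    mainProc.body = triplesCode ++ (squaresCode ++ (degreesCode ++ resultCode)) := rfl

theorem runs_mainProc [NeZero n] [DecidableRel G.Adj] (hG : G.IsTree) (hA : A.Represents G)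
    (hM : 10 * (n : ℤ) ^ 3 ≤ M) :
    ∃ μ : Memory, μ.loc[6]? = some
        ((n - 1) * (3 * n ^ 2 + 2 * n - 2) - ∑ u, (2 * (G.degree u : ℤ) - 1) * sumSq G u) ∧
      μ.loc[7]? = some (6 * (n : ℤ)) ∧
      Runs computeExpectedPlanar A M (201 * n) mainProc.body
        ⟨List.replicate 8 0, List.replicate 5 []⟩ μ := by
  have hn : (1 : ℤ) ≤ n := by exact_mod_cast NeZero.one_le (n := n)
  have hle : (n : ℤ) ^ 2 ≤ (n : ℤ) ^ 3 := pow_le_pow_right₀ hn (by norm_num)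
  have hM2 : 2 * (n : ℤ) ≤ M := by nlinarith
  have hsum := sum_abs_degree_mul_sumSq_le hG
  obtain ⟨T, a, w, r, hlength, hT, htriples⟩ := runs_triplesCode hG hA hM2
  have hsquares : ∀ v, squares G T v ≤ M := fun v => by
    rw [squares_eq_sumSq hT]
    linarith [sumSq_le hG v]
  obtain ⟨i, u, hsquaresCode⟩ := runs_squaresCode (P := computeExpectedPlanar) (A := A) hM2
    hlength.le hsquares a w r
  rw [squares_eq_sumSq hT] at hsquaresCode
  have hdegrees := runs_degreesCode (P := computeExpectedPlanar) (G := G) (l := T) hM2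
    (f := sumSq G) (g := fun u => (2 * (G.degree u : ℤ) - 1) * sumSq G u)
    (fun v => by rw [hA.length_eq_degree]) (by linarith) a w r i u
  have hresult := runs_resultCode (P := computeExpectedPlanar) (A := A) hM
    ((Finset.abs_sum_le_sum_abs _ _).trans hsum) a w r i n (fullHeap G T (sumSq G))
  rw [mainProc_body]
  exact ⟨_, rfl, rfl, (htriples.append <| hsquaresCode.append <| hdegrees.append hresult).mono
    (by omega)⟩

theorem AdjLists.Represents.sum_length (hG : G.IsTree) (hA : A.Represents G) :
    (∑ u, (A u).length : ℤ) = 2 * (n - 1) := by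
  classical
  simp only [hA.length_eq_degree, sum_degree hG, Fintype.card_fin]

theorem space_init_le (hG : G.IsTree) (hA : A.Represents G) :
    computeExpectedPlanar.init.space A ≤ 30 * n := by
  have hn : 0 < n := Fin.pos_iff_nonempty.2 hG.connected.nonempty
  have hlength := hA.sum_length hG
  have hspace : computeExpectedPlanar.init.space A = n + ∑ u, (A u).length + 22 := by
    simp [Config.space, Config.words, AdjLists.size, Program.init, computeExpectedPlanar, mainProc]
  rw [hspace]
  zify at hn ⊢
  omega

end Correctness

end PlanarSum

theorem mainTheorem5 :
    ∃ C : ℕ, ∀ (n : ℕ) (G : SimpleGraph (Fin n)), G.IsTree →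
      ∀ A : PlanarSum.AdjLists n, A.Represents G →
        ∃ (k : ℕ) (c : PlanarSum.Config) (p q : ℤ),
          PlanarSum.computeExpectedPlanar.run A k = some c ∧
          PlanarSum.computeExpectedPlanar.Returns c p q ∧
          q ≠ 0 ∧ PlanarSum.expectedPlanar G = (p : ℚ) / (q : ℚ) ∧
          c.clock ≤ C * n ∧
          ∀ j ≤ k, ∃ d : PlanarSum.Config,
            PlanarSum.computeExpectedPlanar.run A j = some d ∧
            d.space A ≤ C * n ∧
            ∀ w ∈ d.words, |w| ≤ (C : ℤ) * (n : ℤ) ^ 3 := by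
  refine ⟨10000, fun n G hG A hA => ?_⟩
  classical
  have hn : NeZero n := ⟨(Fin.pos_iff_nonempty.2 hG.connected.nonempty).ne'⟩
  have hcube : 0 ≤ (n : ℤ) ^ 3 := by positivity
  obtain ⟨μ, hnum, hden, hruns⟩ :=
    PlanarSum.runs_mainProc (M := 10000 * (n : ℤ) ^ 3) hG hA (by linarith)
  obtain ⟨k, c, hrun, hcode, hstack, hloc, hclock, hbefore⟩ := hruns.exists_run (by positivity)
  refine ⟨k, c, _, _, hrun, ⟨hcode, hstack, hloc ▸ hnum, hloc ▸ hden⟩, ?_,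
    PlanarSum.expectedPlanar_eq hG, hclock.trans (by omega), fun j hj => ?_⟩
  · simp [hn.ne]
  · obtain ⟨d, hd, hbound, hspace⟩ := hbefore j hj
    have := PlanarSum.space_init_le hG hA
    exact ⟨d, hd, by omega, hbound⟩
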